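/- Let $n\ge 3$, let $\Omega\subset\mathbb R^n$ be a bounded domain (a nonempty, bounded, connected open set), and let $0<\alpha<\beta<1$. Let $H^1_0(\Omega)$ be the closure of $C_0^\infty(\Omega)$ in the Sobolev space $H^1(\Omega)$ of real-valued functions. For $u\in H^1_0(\Omega)$ and $\lambda\in\mathbb R$ put $$T(u)=\int_\Omega|\nabla u|^2\,dx,\qquad B(u)=\int_\Omega|u|^{\beta+1}\,dx,\qquad A(u)=\int_\Omega|u|^{\alpha+1}\,dx,$$ $$E_\lambda(u)=\tfrac12T(u)-\tfrac{\lambda}{\beta+1}B(u)+\tfrac1{\alpha+1}A(u),\qquad Q_\lambda(u)=T(u)-\lambda B(u)+A(u),$$ $$M_\lambda=\{u\in H^1_0(\Omega)\setminus\{0\}:\ Q_\lambda(u)=0\},$$ and let $$\Lambda_1=\inf_{u\in H^1_0(\Omega)\setminus\{0\}}\ \frac{1-\alpha}{1-\beta}\left(\frac{1-\beta}{\beta-\alpha}\right)^{\frac{\beta-\alpha}{1-\alpha}}\frac{A(u)^{\frac{1-\beta}{1-\alpha}}\,T(u)^{\frac{\beta-\alpha}{1-\alpha}}}{B(u)}.$$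 Then for every $\lambda>\Lambda_1$ the problem of minimizing $E_\lambda$ over $M_\lambda$ has a solution: there is $u_0\in H^1_0(\Omega)\setminus\{0\}$ with $u_0\in M_\lambda$ and $E_\lambda(u_0)=\min\{E_\lambda(u):u\in M_\lambda\}$. -/

import Mathlib

open MeasureTheory
open scoped ContDiff

noncomputable section

/-- Test functions on `Ω`: real-valued smooth functions whose support is a compact subset of `Ω`. -/
def IsTestFunction {n : ℕ} (Ω : Set (EuclideanSpace ℝ (Fin n)))
    (φ : EuclideanSpace ℝ (Fin n) → ℝ) : Prop :=
  ContDiff ℝ ∞ φ ∧ HasCompactSupport φ ∧ tsupport φ ⊆ Ω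

/-- `g` is the weak gradient of `u` on `Ω`:
`∫_Ω u ∂_v φ dx = - ∫_Ω (g · v) φ dx` for all test functions `φ` and all directions `v`. -/
def IsWeakGradient {n : ℕ} (Ω : Set (EuclideanSpace ℝ (Fin n)))
    (u : EuclideanSpace ℝ (Fin n) → ℝ)
    (g : EuclideanSpace ℝ (Fin n) → EuclideanSpace ℝ (Fin n)) : Prop :=
  ∀ φ : EuclideanSpace ℝ (Fin n) → ℝ, IsTestFunction Ω φ →
    ∀ v : EuclideanSpace ℝ (Fin n),
      ∫ x in Ω, u x * fderiv ℝ φ x v = - ∫ x in Ω, inner ℝ (g x) v * φ x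

theorem IsTestFunction.zero {n : ℕ} (Ω : Set (EuclideanSpace ℝ (Fin n))) :
    IsTestFunction Ω (fun _ => 0) := by
  refine ⟨contDiff_const, HasCompactSupport.zero, ?_⟩
  have h : tsupport (fun _ : EuclideanSpace ℝ (Fin n) => (0 : ℝ)) = ∅ :=
    tsupport_eq_empty_iff.2 rfl
  simp [h]

theorem IsTestFunction.add {n : ℕ} {Ω : Set (EuclideanSpace ℝ (Fin n))}
    {φ ψ : EuclideanSpace ℝ (Fin n) → ℝ} (hφ : IsTestFunction Ω φ) (hψ : IsTestFunction Ω ψ) :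
    IsTestFunction Ω (fun x => φ x + ψ x) :=
  ⟨hφ.1.add hψ.1, hφ.2.1.add hψ.2.1,
    (tsupport_add φ ψ).trans (Set.union_subset hφ.2.2 hψ.2.2)⟩

theorem IsTestFunction.const_mul {n : ℕ} {Ω : Set (EuclideanSpace ℝ (Fin n))}
    {φ : EuclideanSpace ℝ (Fin n) → ℝ} (c : ℝ) (hφ : IsTestFunction Ω φ) :
    IsTestFunction Ω (fun x => c * φ x) :=
  ⟨contDiff_const.mul hφ.1, hφ.2.1.mul_left,
    (tsupport_mul_subset_right (f := fun _ => c) (g := φ)).trans hφ.2.2⟩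

theorem IsTestFunction.memLp {n : ℕ} {Ω : Set (EuclideanSpace ℝ (Fin n))}
    {φ : EuclideanSpace ℝ (Fin n) → ℝ} (hφ : IsTestFunction Ω φ) :
    MemLp φ 2 (volume.restrict Ω) :=
  (hφ.1.continuous.memLp_of_hasCompactSupport hφ.2.1).restrict Ω

theorem IsTestFunction.memLp_fderiv {n : ℕ} {Ω : Set (EuclideanSpace ℝ (Fin n))}
    {φ : EuclideanSpace ℝ (Fin n) → ℝ} (hφ : IsTestFunction Ω φ)
    (v : EuclideanSpace ℝ (Fin n)) :
    MemLp (fun x => fderiv ℝ φ x v) 2 (volume.restrict Ω) :=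
  (((hφ.1.continuous_fderiv (by simp)).clm_apply
    continuous_const).memLp_of_hasCompactSupport (hφ.2.1.fderiv_apply ℝ v)).restrict Ω

/-- The Sobolev space `H¹(Ω)`: the pairs `(u, ∇u)` of a class `u ∈ L²(Ω)` and its weak gradient
`∇u ∈ L²(Ω; ℝⁿ)`, with the norm `(‖u‖²_{L²} + ‖∇u‖²_{L²})^{1/2}`. -/
def H1 {n : ℕ} (Ω : Set (EuclideanSpace ℝ (Fin n))) :
    Submodule ℝ (WithLp 2 (Lp ℝ 2 (volume.restrict Ω) ×
      Lp (EuclideanSpace ℝ (Fin n)) 2 (volume.restrict Ω))) where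
  carrier := {w | IsWeakGradient Ω w.fst w.snd}
  zero_mem' := by
    intro φ _ v
    have h1 : ∀ᵐ x ∂(volume.restrict Ω), (0 : Lp ℝ 2 (volume.restrict Ω)) x *
        fderiv ℝ φ x v = 0 := by
      filter_upwards [Lp.coeFn_zero ℝ 2 (volume.restrict Ω)] with x hx
      erw [hx]
      simp
    have h2 : ∀ᵐ x ∂(volume.restrict Ω),
        inner ℝ ((0 : Lp (EuclideanSpace ℝ (Fin n)) 2 (volume.restrict Ω)) x) v * φ x = 0 := by
      filter_upwards [Lp.coeFn_zero (EuclideanSpace ℝ (Fin n)) 2 (volume.restrict Ω)] with x hx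
      erw [hx]
      simp
    simp only [WithLp.zero_fst, WithLp.zero_snd]
    rw [integral_eq_zero_of_ae h1, integral_eq_zero_of_ae h2, neg_zero]
  add_mem' := by
    intro a b ha hb φ hφ v
    have h1 : ∀ᵐ x ∂(volume.restrict Ω), (a + b).fst x * fderiv ℝ φ x v
        = a.fst x * fderiv ℝ φ x v + b.fst x * fderiv ℝ φ x v := by
      filter_upwards [Lp.coeFn_add a.fst b.fst] with x hx
      simp only [WithLp.add_fst, hx, Pi.add_apply, add_mul]
    have h2 : ∀ᵐ x ∂(volume.restrict Ω), inner ℝ ((a + b).snd x) v * φ x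
        = inner ℝ (a.snd x) v * φ x + inner ℝ (b.snd x) v * φ x := by
      filter_upwards [Lp.coeFn_add a.snd b.snd] with x hx
      simp only [WithLp.add_snd, hx, Pi.add_apply, inner_add_left, add_mul]
    rw [integral_congr_ae h1, integral_congr_ae h2, integral_add, integral_add, ha φ hφ v,
      hb φ hφ v, neg_add]
    · exact ((Lp.memLp a.snd).inner_const v).integrable_mul hφ.memLp
    · exact ((Lp.memLp b.snd).inner_const v).integrable_mul hφ.memLp
    · exact (Lp.memLp a.fst).integrable_mul (hφ.memLp_fderiv v)
    · exact (Lp.memLp b.fst).integrable_mul (hφ.memLp_fderiv v)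
  smul_mem' := by
    intro c a ha φ hφ v
    have h1 : ∀ᵐ x ∂(volume.restrict Ω), (c • a).fst x * fderiv ℝ φ x v
        = c * (a.fst x * fderiv ℝ φ x v) := by
      filter_upwards [Lp.coeFn_smul c a.fst] with x hx
      simp only [WithLp.smul_fst, hx, Pi.smul_apply, smul_eq_mul, mul_assoc]
    have h2 : ∀ᵐ x ∂(volume.restrict Ω), inner ℝ ((c • a).snd x) v * φ x
        = c * (inner ℝ (a.snd x) v * φ x) := by
      filter_upwards [Lp.coeFn_smul c a.snd] with x hx
      simp only [WithLp.smul_snd, hx, Pi.smul_apply, real_inner_smul_left, mul_assoc]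
    rw [integral_congr_ae h1, integral_congr_ae h2, integral_const_mul, integral_const_mul,
      ha φ hφ v, mul_neg]

/-- The function in `L²(Ω)` underlying an element of `H¹(Ω)`. -/
def h1Fun {n : ℕ} {Ω : Set (EuclideanSpace ℝ (Fin n))} (w : H1 Ω) :
    EuclideanSpace ℝ (Fin n) → ℝ :=
  (w : WithLp 2 (Lp ℝ 2 (volume.restrict Ω) ×
    Lp (EuclideanSpace ℝ (Fin n)) 2 (volume.restrict Ω))).fst

/-- The weak gradient of an element of `H¹(Ω)`. -/
def h1Grad {n : ℕ} {Ω : Set (EuclideanSpace ℝ (Fin n))} (w : H1 Ω) :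
    EuclideanSpace ℝ (Fin n) → EuclideanSpace ℝ (Fin n) :=
  (w : WithLp 2 (Lp ℝ 2 (volume.restrict Ω) ×
    Lp (EuclideanSpace ℝ (Fin n)) 2 (volume.restrict Ω))).snd

/-- `C₀^∞(Ω)` as a linear subspace of `H¹(Ω)`. -/
def testSubspace {n : ℕ} (Ω : Set (EuclideanSpace ℝ (Fin n))) : Submodule ℝ (H1 Ω) where
  carrier := {w | ∃ φ : EuclideanSpace ℝ (Fin n) → ℝ,
    IsTestFunction Ω φ ∧ h1Fun w =ᵐ[volume.restrict Ω] φ}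
  zero_mem' := ⟨_, IsTestFunction.zero Ω, Lp.coeFn_zero ℝ 2 (volume.restrict Ω)⟩
  add_mem' := by
    rintro a b ⟨φ, hφ, ha⟩ ⟨ψ, hψ, hb⟩
    refine ⟨_, hφ.add hψ, ?_⟩
    filter_upwards [Lp.coeFn_add a.1.fst b.1.fst, ha, hb] with x hx hax hbx
    exact hx.trans (congrArg₂ (· + ·) hax hbx)
  smul_mem' := by
    rintro c a ⟨φ, hφ, ha⟩
    refine ⟨_, hφ.const_mul c, ?_⟩
    filter_upwards [Lp.coeFn_smul c a.1.fst, ha] with x hx hax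
    exact hx.trans (congrArg (c * ·) hax)

/-- `H¹₀(Ω)`: the closure of `C₀^∞(Ω)` in `H¹(Ω)`. -/
def H10 {n : ℕ} (Ω : Set (EuclideanSpace ℝ (Fin n))) : Submodule ℝ (H1 Ω) :=
  (testSubspace Ω).topologicalClosure

/-- `T(u) = ∫_Ω |∇u|² dx`. -/
def dirichletT {n : ℕ} {Ω : Set (EuclideanSpace ℝ (Fin n))} (u : H10 Ω) : ℝ :=
  ∫ x in Ω, ‖h1Grad (u : H1 Ω) x‖ ^ 2

/-- `∫_Ω |u|^(r+1) dx`; this is `A(u)` for `r = α` and `B(u)` for `r = β`. -/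
def powerIntegral {n : ℕ} {Ω : Set (EuclideanSpace ℝ (Fin n))} (r : ℝ) (u : H10 Ω) : ℝ :=
  ∫ x in Ω, |h1Fun (u : H1 Ω) x| ^ (r + 1)

/-- `E_lam(u) = T(u)/2 - lam B(u)/(β+1) + A(u)/(α+1)`. -/
def energyE {n : ℕ} {Ω : Set (EuclideanSpace ℝ (Fin n))} (α β lam : ℝ) (u : H10 Ω) : ℝ :=
  1 / 2 * dirichletT u - lam * (1 / (β + 1)) * powerIntegral β u
    + 1 / (α + 1) * powerIntegral α u

/-- `Q_lam(u) = T(u) - lam B(u) + A(u)`, the derivative of `t ↦ E_lam(tu)` at `t = 1`. -/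
def nehariQ {n : ℕ} {Ω : Set (EuclideanSpace ℝ (Fin n))} (α β lam : ℝ) (u : H10 Ω) : ℝ :=
  dirichletT u - lam * powerIntegral β u + powerIntegral α u

/-- The admissible set `M_lam` of the nonzero `u ∈ H¹₀(Ω)` with `Q_lam(u) = 0`. -/
def nehariM {n : ℕ} (Ω : Set (EuclideanSpace ℝ (Fin n))) (α β lam : ℝ) : Set (H10 Ω) :=
  {u | u ≠ 0 ∧ nehariQ α β lam u = 0}

/-- `lam(u) = A(u)^((1-β)/(1-α)) T(u)^((β-α)/(1-α)) / B(u)`. -/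
def fiberQuotient {n : ℕ} {Ω : Set (EuclideanSpace ℝ (Fin n))} (α β : ℝ) (u : H10 Ω) : ℝ :=
  powerIntegral α u ^ ((1 - β) / (1 - α)) * dirichletT u ^ ((β - α) / (1 - α))
    / powerIntegral β u

/-- The constant `c₁^{α,β}`. -/
def c1Const (α β : ℝ) : ℝ :=
  (1 - α) / (1 - β) * ((1 - β) / (β - α)) ^ ((β - α) / (1 - α))

/-- `lam₁(u) = c₁^{α,β} lam(u)`: for `u ≠ 0` this is the value of `lam` for which the system
`Q_lam(tu) = 0`, `(d²/ds²) E_lam(stu) |_{s=1} = 0` has a solution `t > 0`. -/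
def lambda1 {n : ℕ} {Ω : Set (EuclideanSpace ℝ (Fin n))} (α β : ℝ) (u : H10 Ω) : ℝ :=
  c1Const α β * fiberQuotient α β u

/-- The spectral point `Λ₁ = inf { lam₁(u) : u ∈ H¹₀(Ω), u ≠ 0 }`, an infimum of nonnegative
numbers. -/
def Lambda1 {n : ℕ} (Ω : Set (EuclideanSpace ℝ (Fin n))) (α β : ℝ) : ℝ :=
  sInf (lambda1 α β '' {u : H10 Ω | u ≠ 0})

end

/-!
The functional is minimized by the direct method, over the larger set
`N = {u ≠ 0 : Q(u) ≤ 0}` in place of the Nehari set `M = {u ≠ 0 : Q(u) = 0}`. This loses nothing: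
since `β + 1 < 2`, for `u ∈ N` the fiber `t ↦ Q(tu)` has a first zero `t ≥ 1`, and because
`d/dt E(tu) = Q(tu) / t ≤ 0` up to that zero, `tu ∈ M` and `E(tu) ≤ E(u)` (`exists_fiber_zero`).
So a minimizer over `N`, moved along its fiber, is a minimizer over `M`. The hypothesis
`λ > Λ₁` gives `λ > 0` and makes `N` nonempty: `λ₁(u)` is the minimum over `t > 0` of
`t ↦ (t² T(u) + t^(α+1) A(u)) / (t^(β+1) B(u))` (`exists_fiber_nonpos`).

A minimizing sequence in `N` is written `u_k = τ_k v_k` with `T(v_k) = 1`. On `N` one has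
`T ≤ λ B ≤ C T^((β+1)/2)`, so `τ_k` is bounded, and after passing to a subsequence `τ_k → τ`, while
`v_k` converges to some `v` weakly in `H¹₀(Ω)` and strongly in `L²(Ω)`. Two facts keep `τ v` away
from zero.

* `v ≠ 0` (`ne_zero_of_tendsto`): with `θ = (1-β)/(1-α)`, the constraint gives
  `A^θ T^(1-θ) ≤ λ B`, and Hölder's inequality gives `B ≤ A^θ ‖u‖₂^(2(1-θ))`; cancelling `A^θ`
  bounds the `L²` norm of `v_k` from below.
* `τ > 0` (`pos_of_tendsto`): the constraint gives `A(v_k) ≤ λ τ_k^(β-α) B(v_k)`, and `A(v) > 0`.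

Since `A` and `B` are continuous in `L²` and `T(v) ≤ 1`, the function `τ v` lies in `N` and has
minimal energy (`IsH10Model.exists_minimizer_nonpos`).

The Poincaré inequality and the Rellich theorem for `H¹₀(Ω)` both rest on the estimate
`∫ φ² - ∫ φ(x) φ(x + h) dx ≤ (|h|² / 2) ∫ |∇φ|²` for test functions. If `|h|` exceeds the diameter
of `Ω`, the correlation vanishes and this is Poincaré's inequality. Averaged over `|h| < ε`, it
bounds `∫ φ²` by `ε² ∫ |∇φ|²` plus a multiple of `∫_Ω (∫_{B(x,ε)} φ)² dx`, and the last term tends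
to zero along a weakly null sequence by dominated convergence (`tendsto_integral_sq_zero`).
-/

open Filter Topology

/-! ### Weak sequential compactness -/

/-- Bounded sequences in a Hilbert space, separable or not, have weakly convergent subsequences: the
sequential Banach-Alaoglu theorem applies in the closed span of the sequence, which is separable. -/
theorem exists_subseq_tendsto_weakly {H : Type*} [NormedAddCommGroup H] [InnerProductSpace ℝ H]
    [CompleteSpace H] {u : ℕ → H} {C : ℝ} (hu : ∀ k, ‖u k‖ ≤ C) :
    ∃ v : H, ∃ φ : ℕ → ℕ, StrictMono φ ∧
      ∀ f : H →L[ℝ] ℝ, Tendsto (fun k => f (u (φ k))) atTop (𝓝 (f v)) := by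
  set K : Submodule ℝ H := (Submodule.span ℝ (Set.range u)).topologicalClosure with hK
  have hmem : ∀ k, u k ∈ K := fun k =>
    Submodule.le_topologicalClosure _ (Submodule.subset_span ⟨k, rfl⟩)
  have hsep : TopologicalSpace.IsSeparable (K : Set H) := by
    rw [hK, Submodule.topologicalClosure_coe]
    exact ((Set.countable_range u).isSeparable.span (R := ℝ)).closure
  have : TopologicalSpace.SeparableSpace K := hsep.separableSpace
  have hball : ∀ k, StrongDual.toWeakDual (InnerProductSpace.toDual ℝ K ⟨u k, hmem k⟩) ∈
      WeakDual.toStrongDual ⁻¹' Metric.closedBall (0 : StrongDual ℝ K) C := by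
    intro k
    rw [Set.mem_preimage, Metric.mem_closedBall]
    refine (dist_zero_right (InnerProductSpace.toDual ℝ K ⟨u k, hmem k⟩)).trans_le ?_
    change ‖InnerProductSpace.toDual ℝ K ⟨u k, hmem k⟩‖ ≤ C
    rw [LinearIsometryEquiv.norm_map]
    exact hu k
  obtain ⟨a, -, φ, hφ, hlim⟩ := WeakDual.isSeqCompact_closedBall ℝ K 0 C hball
  refine ⟨((InnerProductSpace.toDual ℝ K).symm (WeakDual.toStrongDual a) : K), φ, hφ, fun f => ?_⟩
  set y : K := (InnerProductSpace.toDual ℝ K).symm (f.comp K.subtypeL) with hy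
  have hf : ∀ x : K, f x = inner ℝ y x := by
    intro x
    rw [hy, InnerProductSpace.toDual_symm_apply]
    rfl
  have h1 := ((WeakDual.eval_continuous y).tendsto a).comp hlim
  have h2 : f ((InnerProductSpace.toDual ℝ K).symm (WeakDual.toStrongDual a) : K) = a y := by
    rw [hf, real_inner_comm, InnerProductSpace.toDual_symm_apply]
    rfl
  rw [h2]
  refine h1.congr fun k => ?_
  have h3 := hf ⟨u (φ k), hmem (φ k)⟩
  rw [h3, real_inner_comm]
  rfl

/-! ### Power integrals -/

section PowerIntegral

variable {X : Type*} [MeasurableSpace X] {μ : Measure X}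

theorem integral_abs_rpow_eq_lpNorm_rpow {f : X → ℝ} (hf : AEStronglyMeasurable f μ) {p : ℝ}
    (hp : 0 < p) : ∫ x, |f x| ^ p ∂μ = lpNorm f (ENNReal.ofReal p) μ ^ p := by
  have h0 : ENNReal.ofReal p ≠ 0 := by simpa using hp
  rw [lpNorm_eq_integral_norm_rpow_toReal h0 ENNReal.ofReal_ne_top hf, ENNReal.toReal_ofReal hp.le,
    ← Real.rpow_mul (integral_nonneg fun x => by positivity), inv_mul_cancel₀ hp.ne', Real.rpow_one]
  rfl

/-- On a finite measure space, `u ↦ ∫ |u|^p` is continuous on `L²` for `1 ≤ p ≤ 2`, because the `L^p`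
norm is dominated by the `L²` norm. -/
theorem tendsto_integral_abs_rpow [IsFiniteMeasure μ] {p : ℝ} (hp1 : 1 ≤ p) (hp2 : p ≤ 2)
    {ι : Type*} {l : Filter ι} {f : ι → Lp ℝ 2 μ} {g : Lp ℝ 2 μ} (h : Tendsto f l (𝓝 g)) :
    Tendsto (fun i => ∫ x, |f i x| ^ p ∂μ) l (𝓝 (∫ x, |g x| ^ p ∂μ)) := by
  have hp0 : 0 < p := by linarith
  have hq2 : ENNReal.ofReal p ≤ 2 := by
    rw [← ENNReal.ofReal_ofNat 2]; exact ENNReal.ofReal_le_ofReal hp2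
  have hq1 : 1 ≤ ENNReal.ofReal p := by simpa using hp1
  have hmem : ∀ w : Lp ℝ 2 μ, MemLp w (ENNReal.ofReal p) μ := fun w =>
    (Lp.memLp w).mono_exponent hq2
  simp_rw [fun w : Lp ℝ 2 μ => integral_abs_rpow_eq_lpNorm_rpow (Lp.memLp w).1 hp0]
  refine Tendsto.rpow_const ?_ (Or.inr hp0.le)
  set c : ENNReal := μ Set.univ ^ (1 / (ENNReal.ofReal p).toReal - 1 / (2 : ENNReal).toReal) with hc
  have hct : c ≠ ⊤ := by
    refine ENNReal.rpow_ne_top_of_nonneg ?_ (measure_ne_top _ _)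
    rw [ENNReal.toReal_ofReal hp0.le, ENNReal.toReal_ofNat, sub_nonneg]
    exact one_div_le_one_div_of_le hp0 hp2
  have hbound : ∀ w : Lp ℝ 2 μ, lpNorm w (ENNReal.ofReal p) μ ≤ ‖w‖ * c.toReal := by
    intro w
    rw [← toReal_eLpNorm (Lp.memLp w).1, Lp.norm_def, ← ENNReal.toReal_mul]
    exact ENNReal.toReal_mono (ENNReal.mul_ne_top (Lp.memLp w).2.ne hct)
      (eLpNorm_le_eLpNorm_mul_rpow_measure_univ hq2 (Lp.memLp w).1)
  have hdiff : ∀ w z : Lp ℝ 2 μ, |lpNorm w (ENNReal.ofReal p) μ - lpNorm z (ENNReal.ofReal p) μ| ≤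
      ‖w - z‖ * c.toReal := by
    have key : ∀ w z : Lp ℝ 2 μ, lpNorm w (ENNReal.ofReal p) μ - lpNorm z (ENNReal.ofReal p) μ ≤
      ‖w - z‖ * c.toReal := by
      intro w z
      have h1 := lpNorm_le_lpNorm_add_lpNorm_sub' (f := w) (hmem z) hq1
      have h2 : lpNorm (⇑w - ⇑z) (ENNReal.ofReal p) μ =
          lpNorm (w - z : Lp ℝ 2 μ) (ENNReal.ofReal p) μ := by
        rw [← toReal_eLpNorm ((Lp.memLp w).1.sub (Lp.memLp z).1), ← toReal_eLpNorm (Lp.memLp _).1,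
          eLpNorm_congr_ae (Lp.coeFn_sub w z)]
      have h3 := hbound (w - z)
      linarith
    intro w z
    rw [abs_le]
    constructor
    · have := key z w
      rw [norm_sub_rev] at this
      linarith
    · exact key w z
  have h0 : Tendsto (fun i => ‖f i - g‖ * c.toReal) l (𝓝 0) := by
    simpa using (tendsto_iff_norm_sub_tendsto_zero.1 h).mul_const c.toReal
  rw [tendsto_iff_dist_tendsto_zero]
  exact squeeze_zero (fun i => dist_nonneg) (fun i => hdiff (f i) g) h0

/-- Hölder's inequality, interpolating the exponent `q` between `p` and `2`. -/
theorem integral_abs_rpow_interpolation [IsFiniteMeasure μ] {f : X → ℝ} (hf : MemLp f 2 μ)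
    {p q θ : ℝ} (hp : 0 < p) (hp2 : p ≤ 2) (hθ0 : 0 ≤ θ) (hθ1 : θ ≤ 1)
    (hq : q = p * θ + 2 * (1 - θ)) :
    ∫ x, |f x| ^ q ∂μ ≤ (∫ x, |f x| ^ p ∂μ) ^ θ * (∫ x, f x ^ 2 ∂μ) ^ (1 - θ) := by
  have hm : AEMeasurable f μ := hf.1.aemeasurable
  have hint : Integrable (fun x => |f x| ^ p) μ := by
    have h := (hf.mono_exponent (p := ENNReal.ofReal p) (by
      rw [← ENNReal.ofReal_ofNat 2]; exact ENNReal.ofReal_le_ofReal hp2)).integrable_norm_rpow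
      (by simpa using hp) ENNReal.ofReal_ne_top
    simpa [ENNReal.toReal_ofReal hp.le] using h
  have hint2 : Integrable (fun x => f x ^ 2) μ := hf.integrable_sq
  have hH := ENNReal.lintegral_mul_norm_pow_le (μ := μ)
    (f := fun x => ENNReal.ofReal (|f x| ^ p)) (g := fun x => ENNReal.ofReal (f x ^ 2))
    (by fun_prop) (by fun_prop) hθ0 (sub_nonneg.2 hθ1) (by ring)
  rw [← ofReal_integral_eq_lintegral_ofReal hint (Eventually.of_forall fun x => by positivity),
    ← ofReal_integral_eq_lintegral_ofReal hint2 (Eventually.of_forall fun x => by positivity)] at hH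
  have hA : 0 ≤ ∫ x, |f x| ^ p ∂μ := integral_nonneg fun x => by positivity
  have hB : 0 ≤ ∫ x, f x ^ 2 ∂μ := integral_nonneg fun x => by positivity
  rw [ENNReal.ofReal_rpow_of_nonneg hA hθ0, ENNReal.ofReal_rpow_of_nonneg hB (sub_nonneg.2 hθ1),
    ← ENNReal.ofReal_mul (by positivity)] at hH
  rw [integral_eq_lintegral_of_nonneg_ae (Eventually.of_forall fun x => by positivity)
    ((hm.abs.pow_const q).aestronglyMeasurable)]
  refine ENNReal.toReal_le_of_le_ofReal (by positivity) (le_trans (lintegral_mono fun x => ?_) hH)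
  dsimp only
  rw [ENNReal.ofReal_rpow_of_nonneg (by positivity) hθ0,
    ENNReal.ofReal_rpow_of_nonneg (by positivity) (sub_nonneg.2 hθ1),
    ← ENNReal.ofReal_mul (by positivity)]
  apply ENNReal.ofReal_le_ofReal
  rw [← Real.rpow_mul (abs_nonneg _), ← sq_abs, ← Real.rpow_natCast |f x| 2,
    ← Real.rpow_mul (abs_nonneg _), hq]
  push_cast
  exact (Real.rpow_add_of_nonneg (abs_nonneg _) (by positivity)
    (mul_nonneg zero_le_two (sub_nonneg.2 hθ1))).le

end PowerIntegral

/-! ### Fibers of the functionals -/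

section Fibering

/-- Here `T`, `b`, `A` stand for `T(u)`, `λ B(u)`, `A(u)`. If `Q(u) ≤ 0`, then `Q(tu)` vanishes for
some `t ≥ 1`, and at the first such `t` the energy satisfies `E(tu) ≤ E(u)`, since
`d/ds E(su) = Q(su) / s ≤ 0` for `1 ≤ s ≤ t`. -/
theorem exists_fiber_zero {α β T A b : ℝ} (hα : 0 < α) (hβ : β < 1) (hαβ : α < β) (hT : 0 < T)
    (hq : T - b + A ≤ 0) (hA : 0 ≤ A) :
    ∃ t : ℝ, 1 ≤ t ∧ t ^ 2 * T - t ^ (β + 1) * b + t ^ (α + 1) * A = 0 ∧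
      1 / 2 * (t ^ 2 * T) - 1 / (β + 1) * (t ^ (β + 1) * b) + 1 / (α + 1) * (t ^ (α + 1) * A) ≤
        1 / 2 * T - 1 / (β + 1) * b + 1 / (α + 1) * A := by
  set q : ℝ → ℝ := fun t => t ^ 2 * T - t ^ (β + 1) * b + t ^ (α + 1) * A with hqdef
  set e : ℝ → ℝ := fun t => 1 / 2 * (t ^ 2 * T) - 1 / (β + 1) * (t ^ (β + 1) * b)
    + 1 / (α + 1) * (t ^ (α + 1) * A) with hedef
  have hcont : ∀ r : ℝ, 0 < r → Continuous fun t : ℝ => t ^ (r + 1) := fun r hr =>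
    Real.continuous_rpow_const (by linarith)
  have hβ0 : 0 < β := hα.trans hαβ
  have hqc : Continuous q := by
    have h1 := hcont α hα
    have h2 := hcont β hβ0
    fun_prop
  have hec : Continuous e := by
    have h1 := hcont α hα
    have h2 := hcont β hβ0
    fun_prop
  have hq1 : q 1 ≤ 0 := by simpa [hqdef] using hq
  have hb : 0 < b := by linarith
  -- the quadratic term dominates at infinity because `β + 1 < 2`
  obtain ⟨R, hR1, hR⟩ : ∃ R : ℝ, 1 ≤ R ∧ 0 ≤ q R := by
    have htend := tendsto_rpow_atTop (sub_pos.2 hβ)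
    obtain ⟨R, hR, hR1⟩ := ((htend.eventually_ge_atTop (b / T)).and (eventually_ge_atTop 1)).exists
    refine ⟨R, hR1, ?_⟩
    have hR0 : 0 < R := by linarith
    have h1 : R ^ 2 = R ^ (1 - β) * R ^ (β + 1) := by
      rw [← Real.rpow_add hR0, ← Real.rpow_two]; congr 1; ring
    have h2 : b ≤ R ^ (1 - β) * T := (div_le_iff₀ hT).1 hR
    have h3 : 0 ≤ R ^ (β + 1) * (R ^ (1 - β) * T - b) :=
      mul_nonneg (by positivity) (by linarith)
    have h4 : 0 ≤ R ^ (α + 1) * A := by positivity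
    have h5 : q R = R ^ (β + 1) * (R ^ (1 - β) * T - b) + R ^ (α + 1) * A := by
      simp only [hqdef, h1]; ring
    rw [h5]; linarith
  have hzero : ∀ s, 1 ≤ s → 0 ≤ q s → ∃ r ∈ Set.Icc 1 s, q r = 0 := fun s hs hqs =>
    intermediate_value_Icc hs hqc.continuousOn ⟨hq1, hqs⟩
  have hcpt : IsCompact {s | s ∈ Set.Icc 1 R ∧ q s = 0} :=
    isCompact_Icc.inter_right (isClosed_eq hqc continuous_const)
  obtain ⟨r, hr, hr0⟩ := hzero R hR1 hR
  obtain ⟨t, ⟨⟨ht1, htR⟩, hqt⟩, hmin⟩ := hcpt.exists_isLeast ⟨r, hr, hr0⟩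
  refine ⟨t, ht1, hqt, ?_⟩
  have hneg : ∀ s ∈ Set.Ioo 1 t, q s ≤ 0 := by
    intro s hs
    by_contra! hpos
    obtain ⟨r, hr, hr0⟩ := hzero s hs.1.le hpos.le
    have := hmin ⟨⟨hr.1, by linarith [hr.2, hs.2]⟩, hr0⟩
    linarith [hr.2, hs.2]
  have hderiv : ∀ s, 0 < s → HasDerivAt e (q s / s) s := by
    intro s hs
    have hp : ∀ r : ℝ, HasDerivAt (fun t : ℝ => t ^ (r + 1)) ((r + 1) * s ^ r) s := by
      intro r
      have := Real.hasDerivAt_rpow_const (x := s) (p := r + 1) (Or.inl hs.ne')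
      simpa using this
    have h := ((((hasDerivAt_pow 2 s).mul_const T).const_mul (1 / 2 : ℝ)).sub
      (((hp β).mul_const b).const_mul (1 / (β + 1)))).add
      (((hp α).mul_const A).const_mul (1 / (α + 1)))
    refine h.congr_deriv ?_
    have hα1 : α + 1 ≠ 0 := by positivity
    have hβ1 : β + 1 ≠ 0 := by positivity
    simp only [hqdef, Real.rpow_add_one hs.ne']
    field_simp
    ring
  have hanti : AntitoneOn e (Set.Icc 1 t) := by
    refine antitoneOn_of_deriv_nonpos (convex_Icc 1 t) hec.continuousOn ?_ ?_
    · intro s hs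
      rw [interior_Icc] at hs
      exact (hderiv s (by linarith [hs.1])).differentiableAt.differentiableWithinAt
    · intro s hs
      rw [interior_Icc] at hs
      rw [(hderiv s (by linarith [hs.1])).deriv]
      exact div_nonpos_of_nonpos_of_nonneg (hneg s hs) (by linarith [hs.1])
  have := hanti (Set.left_mem_Icc.2 ht1) (Set.right_mem_Icc.2 ht1) ht1
  simpa [hedef] using this

/-- If `λ₁(u) < λ`, then `Q_λ(tu) ≤ 0` for the value of `t` that minimizes
`(t² T + t^(α+1) A) / (t^(β+1) B)`, namely `t^(1-α) = (β - α) / (1 - β) · A / T`. -/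
theorem exists_fiber_nonpos {α β T A B lam : ℝ} (hαβ : α < β) (hβ : β < 1)
    (hT : 0 < T) (hA : 0 < A) (hB : 0 < B)
    (h : c1Const α β * (A ^ ((1 - β) / (1 - α)) * T ^ ((β - α) / (1 - α)) / B) < lam) :
    ∃ t : ℝ, 0 < t ∧ t ^ 2 * T - lam * (t ^ (β + 1) * B) + t ^ (α + 1) * A ≤ 0 := by
  have h1α : 0 < 1 - α := by linarith
  have h1β : 0 < 1 - β := by linarith
  have hβα : 0 < β - α := by linarith
  set δ := (β - α) / (1 - α) with hδ
  have hδ' : (1 - β) / (1 - α) = 1 - δ := by rw [hδ]; field_simp; ring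
  set κ := (β - α) / (1 - β) with hκ
  have hκ0 : 0 < κ := by positivity
  set y := κ * A / T with hy
  have hy0 : 0 < y := by positivity
  refine ⟨y ^ (1 / (1 - α)), by positivity, ?_⟩
  set t := y ^ (1 / (1 - α)) with ht
  have ht0 : 0 < t := by positivity
  have e1 : t ^ (1 - α) = y := by
    rw [ht, ← Real.rpow_mul hy0.le, one_div_mul_cancel h1α.ne', Real.rpow_one]
  have e2 : t ^ (α - β) = y ^ (-δ) := by
    rw [ht, ← Real.rpow_mul hy0.le]; congr 1; rw [hδ]; field_simp; ring
  have hc : (1 - β) / (β - α) = κ⁻¹ := by rw [hκ, inv_div]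
  have hval : t ^ (α - β) * (t ^ (1 - α) * T + A) =
      c1Const α β * (A ^ (1 - δ) * T ^ δ) := by
    rw [e1, e2, c1Const, ← hδ, hc, Real.inv_rpow hκ0.le, ← Real.rpow_neg hκ0.le, hy,
      Real.div_rpow (by positivity) hT.le, Real.mul_rpow hκ0.le hA.le, Real.rpow_neg hT.le,
      sub_eq_add_neg 1 δ, Real.rpow_add hA, Real.rpow_one]
    have hk1 : (1 - α) / (1 - β) = κ + 1 := by rw [hκ]; field_simp; ring
    rw [hk1]
    have := (Real.rpow_pos_of_pos hT δ).ne'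
    field_simp
  have hle : t ^ (α - β) * (t ^ (1 - α) * T + A) ≤ lam * B := by
    rw [hval, ← hδ']
    rw [← mul_div_assoc, div_lt_iff₀ hB] at h
    exact h.le
  have f1 : t ^ (β + 1) * (t ^ (α - β) * (t ^ (1 - α) * T + A)) = t ^ 2 * T + t ^ (α + 1) * A := by
    have g1 : t ^ (β + 1) * t ^ (α - β) = t ^ (α + 1) := by
      rw [← Real.rpow_add ht0]; ring_nf
    have g2 : t ^ (α + 1) * t ^ (1 - α) = t ^ 2 := by
      rw [← Real.rpow_add ht0, ← Real.rpow_two]; congr 1; ring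
    rw [← mul_assoc, g1, mul_add, ← mul_assoc, g2]
  have f2 := mul_le_mul_of_nonneg_left hle (Real.rpow_pos_of_pos ht0 (β + 1)).le
  rw [f1] at f2
  nlinarith [f2]

end Fibering

/-! ### Translation estimates for test functions -/

section Translation

theorem setIntegral_ball_eq_translate {E : Type*} [NormedAddCommGroup E] [MeasurableSpace E]
    [BorelSpace E] {μ : Measure E} [μ.IsAddLeftInvariant] (φ : E → ℝ) (x : E) (ε : ℝ) :
    ∫ y in Metric.ball x ε, φ y ∂μ = ∫ h in Metric.ball (0 : E) ε, φ (x + h) ∂μ := by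
  have := (measurePreserving_add_left μ x).setIntegral_preimage_emb
    (measurableEmbedding_addLeft x) φ (Metric.ball x ε)
  rw [← this]
  congr 2
  ext y
  simp [dist_eq_norm]

variable {E : Type*} [NormedAddCommGroup E] [NormedSpace ℝ E] {φ : E → ℝ}

theorem sq_sub_translate_le (hφ : ContDiff ℝ 1 φ) (x h : E) :
    (φ (x + h) - φ x) ^ 2 ≤ ∫ t in (0 : ℝ)..1, ‖h‖ ^ 2 * ‖fderiv ℝ φ (x + t • h)‖ ^ 2 := by
  have hc : Continuous fun t : ℝ => fderiv ℝ φ (x + t • h) h :=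
    ((hφ.continuous_fderiv one_ne_zero).comp (by fun_prop)).clm_apply continuous_const
  have hc' : Continuous fun t : ℝ => ‖h‖ ^ 2 * ‖fderiv ℝ φ (x + t • h)‖ ^ 2 :=
    continuous_const.mul (((hφ.continuous_fderiv one_ne_zero).comp (by fun_prop)).norm.pow 2)
  have hftc : ∫ t in (0 : ℝ)..1, fderiv ℝ φ (x + t • h) h = φ (x + h) - φ x := by
    have hd : ∀ t ∈ Set.uIcc (0 : ℝ) 1,
        HasDerivAt (fun t : ℝ => φ (x + t • h)) (fderiv ℝ φ (x + t • h) h) t := by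
      intro t _
      have h1 : HasDerivAt (fun t : ℝ => x + t • h) h t := by
        simpa using ((hasDerivAt_id t).smul_const h).const_add x
      exact ((hφ.differentiable one_ne_zero _).hasFDerivAt).comp_hasDerivAt t h1
    rw [intervalIntegral.integral_eq_sub_of_hasDerivAt hd (hc.intervalIntegrable 0 1)]
    simp
  set c := φ (x + h) - φ x with hcdef
  -- Jensen's inequality for the square, as nonnegativity of a variance
  have hvar : 0 ≤ ∫ t in (0 : ℝ)..1, (fderiv ℝ φ (x + t • h) h - c) ^ 2 :=
    intervalIntegral.integral_nonneg zero_le_one fun t _ => sq_nonneg _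
  have hexp : ∫ t in (0 : ℝ)..1, (fderiv ℝ φ (x + t • h) h - c) ^ 2 =
      (∫ t in (0 : ℝ)..1, (fderiv ℝ φ (x + t • h) h) ^ 2) - c ^ 2 := by
    have e : ∀ t : ℝ, (fderiv ℝ φ (x + t • h) h - c) ^ 2 =
        (fderiv ℝ φ (x + t • h) h) ^ 2 - 2 * c * fderiv ℝ φ (x + t • h) h + c ^ 2 :=
      fun t => by ring
    simp_rw [e]
    rw [intervalIntegral.integral_add, intervalIntegral.integral_sub,
      intervalIntegral.integral_const_mul, hftc, intervalIntegral.integral_const]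
    · simp; ring
    all_goals exact Continuous.intervalIntegrable (by fun_prop) 0 1
  have hle : ∫ t in (0 : ℝ)..1, (fderiv ℝ φ (x + t • h) h) ^ 2 ≤
      ∫ t in (0 : ℝ)..1, ‖h‖ ^ 2 * ‖fderiv ℝ φ (x + t • h)‖ ^ 2 := by
    refine intervalIntegral.integral_mono_on zero_le_one ((hc.pow 2).intervalIntegrable 0 1)
      (hc'.intervalIntegrable 0 1) fun t _ => ?_
    rw [← mul_pow, ← sq_abs, mul_comm]
    exact pow_le_pow_left₀ (abs_nonneg _) ((fderiv ℝ φ (x + t • h)).le_opNorm h) 2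
  linarith

variable [MeasurableSpace E] [BorelSpace E] {μ : Measure E} [μ.IsAddHaarMeasure]

theorem integrable_norm_fderiv_sq (hφ : ContDiff ℝ 1 φ) (hs : HasCompactSupport φ) :
    Integrable (fun x => ‖fderiv ℝ φ x‖ ^ 2) μ := by
  simp_rw [sq]
  have hc := (hφ.continuous_fderiv one_ne_zero).norm
  exact (hc.mul hc).integrable_of_hasCompactSupport (hs.fderiv ℝ).norm.mul_right

theorem integrable_sq_of_hasCompactSupport (hφ : ContDiff ℝ 1 φ) (hs : HasCompactSupport φ) :
    Integrable (fun x => φ x ^ 2) μ := by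
  simp_rw [sq]
  exact (hφ.continuous.mul hφ.continuous).integrable_of_hasCompactSupport hs.mul_right

variable [FiniteDimensional ℝ E]

theorem integral_sq_sub_translate_le (hφ : ContDiff ℝ 1 φ) (hs : HasCompactSupport φ) (h : E) :
    ∫ x, (φ (x + h) - φ x) ^ 2 ∂μ ≤ ‖h‖ ^ 2 * ∫ x, ‖fderiv ℝ φ x‖ ^ 2 ∂μ := by
  have hG := integrable_norm_fderiv_sq (μ := μ) hφ hs
  have hcG : Continuous fun x => ‖fderiv ℝ φ x‖ ^ 2 :=
    (hφ.continuous_fderiv one_ne_zero).norm.pow 2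
  have hcφ := hφ.continuous
  rw [← integral_const_mul]
  rw [integral_eq_lintegral_of_nonneg_ae (Eventually.of_forall fun x => sq_nonneg _)
    (by fun_prop)]
  refine ENNReal.toReal_le_of_le_ofReal (integral_nonneg fun x => by positivity) ?_
  rw [ofReal_integral_eq_lintegral_ofReal (hG.const_mul _)
    (Eventually.of_forall fun x => by positivity)]
  calc ∫⁻ x, ENNReal.ofReal ((φ (x + h) - φ x) ^ 2) ∂μ
      ≤ ∫⁻ x, (∫⁻ t in Set.Ioc (0 : ℝ) 1,
          ENNReal.ofReal (‖h‖ ^ 2 * ‖fderiv ℝ φ (x + t • h)‖ ^ 2)) ∂μ := by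
        refine lintegral_mono fun x => ?_
        have hc' : Continuous fun t : ℝ => ‖h‖ ^ 2 * ‖fderiv ℝ φ (x + t • h)‖ ^ 2 :=
          continuous_const.mul (hcG.comp (by fun_prop : Continuous fun t : ℝ => x + t • h))
        rw [← ofReal_integral_eq_lintegral_ofReal
          (hc'.integrableOn_Ioc) (Eventually.of_forall fun x => by positivity),
          ← intervalIntegral.integral_of_le zero_le_one]
        exact ENNReal.ofReal_le_ofReal (sq_sub_translate_le hφ x h)
    _ = ∫⁻ t in Set.Ioc (0 : ℝ) 1, ∫⁻ x,
          ENNReal.ofReal (‖h‖ ^ 2 * ‖fderiv ℝ φ (x + t • h)‖ ^ 2) ∂μ := by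
        refine lintegral_lintegral_swap ?_
        have : Continuous fun p : E × ℝ => ‖h‖ ^ 2 * ‖fderiv ℝ φ (p.1 + p.2 • h)‖ ^ 2 :=
          continuous_const.mul (hcG.comp (by fun_prop : Continuous fun p : E × ℝ => p.1 + p.2 • h))
        exact this.measurable.ennreal_ofReal.aemeasurable
    _ = ∫⁻ t in Set.Ioc (0 : ℝ) 1, ∫⁻ x,
          ENNReal.ofReal (‖h‖ ^ 2 * ‖fderiv ℝ φ x‖ ^ 2) ∂μ := by
        refine lintegral_congr fun t => ?_
        exact lintegral_add_right_eq_self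
          (fun x => ENNReal.ofReal (‖h‖ ^ 2 * ‖fderiv ℝ φ x‖ ^ 2)) (t • h)
    _ = _ := by simp

/-- The translation estimate with the square expanded. -/
theorem integral_sq_sub_autocorrelation_le (hφ : ContDiff ℝ 1 φ) (hs : HasCompactSupport φ)
    (h : E) :
    ∫ x, φ x ^ 2 ∂μ - ∫ x, φ x * φ (x + h) ∂μ ≤ ‖h‖ ^ 2 / 2 * ∫ x, ‖fderiv ℝ φ x‖ ^ 2 ∂μ := by
  have hcφ := hφ.continuous
  have h1 := integral_sq_sub_translate_le (μ := μ) hφ hs h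
  have i1 : Integrable (fun x => φ x ^ 2) μ :=
    integrable_sq_of_hasCompactSupport hφ hs
  have i2 : Integrable (fun x => φ (x + h) ^ 2) μ := i1.comp_add_right h
  have i3 : Integrable (fun x => φ x * φ (x + h)) μ :=
    (by fun_prop : Continuous fun x => φ x * φ (x + h)).integrable_of_hasCompactSupport
      (hs.mul_right)
  have e : ∀ x, (φ (x + h) - φ x) ^ 2 = φ (x + h) ^ 2 + φ x ^ 2 - 2 * (φ x * φ (x + h)) :=
    fun x => by ring
  simp_rw [e] at h1
  have i4 : Integrable (fun x => φ (x + h) ^ 2 + φ x ^ 2) μ := i2.add i1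
  rw [integral_sub i4 (i3.const_mul 2), integral_add i2 i1, integral_const_mul,
    integral_add_right_eq_self (fun x => φ x ^ 2) h] at h1
  linarith

/-- A Poincaré inequality: the hypothesis holds once `‖h‖` exceeds the diameter of the support. -/
theorem integral_sq_le_of_disjoint_translate (hφ : ContDiff ℝ 1 φ) (hs : HasCompactSupport φ)
    {h : E} (hh : ∀ x, φ x * φ (x + h) = 0) :
    ∫ x, φ x ^ 2 ∂μ ≤ ‖h‖ ^ 2 / 2 * ∫ x, ‖fderiv ℝ φ x‖ ^ 2 ∂μ := by
  simpa [hh] using integral_sq_sub_autocorrelation_le (μ := μ) hφ hs h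

theorem stronglyMeasurable_setIntegral_ball (hφ : Continuous φ) (ε : ℝ) :
    StronglyMeasurable fun x => ∫ y in Metric.ball x ε, φ y ∂μ := by
  have e : (fun x => ∫ y in Metric.ball x ε, φ y ∂μ) =
      fun x => ∫ h in Metric.ball (0 : E) ε, φ (x + h) ∂μ :=
    funext fun x => setIntegral_ball_eq_translate φ x ε
  rw [e]
  have : StronglyMeasurable fun p : E × E => φ (p.1 + p.2) :=
    (by fun_prop : Continuous fun p : E × E => φ (p.1 + p.2)).stronglyMeasurable
  exact this.integral_prod_right'

/-- The translation estimate averaged over `‖h‖ < ε`: up to an error controlled by the gradient, the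
`L²` norm of `φ` is controlled by its means over balls of radius `ε`. -/
theorem integral_sq_le_add_average (hφ : ContDiff ℝ 1 φ) (hs : HasCompactSupport φ) {Ω : Set E}
    (hΩfin : μ Ω ≠ ⊤) (hsupp : ∀ x ∉ Ω, φ x = 0) {ε : ℝ} (hε : 0 < ε) :
    ∫ x, φ x ^ 2 ∂μ ≤ ε ^ 2 * ∫ x, ‖fderiv ℝ φ x‖ ^ 2 ∂μ +
      ((μ.real (Metric.ball 0 ε)) ^ 2)⁻¹ *
        ∫ x in Ω, (∫ y in Metric.ball x ε, φ y ∂μ) ^ 2 ∂μ := by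
  have hcφ := hφ.continuous
  set V := μ.real (Metric.ball (0 : E) ε) with hV
  have hV0 : 0 < V := ENNReal.toReal_pos (Metric.measure_ball_pos μ _ hε).ne' measure_ball_lt_top.ne
  have iφ : Integrable φ μ := hcφ.integrable_of_hasCompactSupport hs
  have i1 : Integrable (fun x => φ x ^ 2) μ :=
    integrable_sq_of_hasCompactSupport hφ hs
  set D := ∫ x, ‖fderiv ℝ φ x‖ ^ 2 ∂μ with hD
  have hD0 : 0 ≤ D := integral_nonneg fun x => by positivity
  set g : E → ℝ := fun x => ∫ y in Metric.ball x ε, φ y ∂μ with hg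
  have hgm : StronglyMeasurable g := stronglyMeasurable_setIntegral_ball hcφ ε
  have hgb : ∀ x, ‖g x‖ ≤ ∫ y, |φ y| ∂μ := fun x =>
    (norm_integral_le_integral_norm _).trans
      (setIntegral_le_integral iφ.norm (Eventually.of_forall fun y => norm_nonneg _))
  obtain ⟨C, hC⟩ := hcφ.bounded_above_of_compact_support hs
  have iprod : Integrable (fun p : E × E => φ p.1 * φ (p.1 + p.2))
      (μ.prod (μ.restrict (Metric.ball 0 ε))) := by
    have : IsFiniteMeasure (μ.restrict (Metric.ball (0 : E) ε)) :=
      ⟨by simpa using measure_ball_lt_top⟩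
    refine (iφ.comp_fst _).mul_bdd (c := C) ?_ ?_
    · exact (by fun_prop : Continuous fun p : E × E => φ (p.1 + p.2)).aestronglyMeasurable
    · exact Eventually.of_forall fun p => hC _
  have hswap : ∫ h in Metric.ball (0 : E) ε, ∫ x, φ x * φ (x + h) ∂μ ∂μ = ∫ x, φ x * g x ∂μ := by
    rw [← integral_integral_swap iprod]
    refine integral_congr_ae (Eventually.of_forall fun x => ?_)
    dsimp only [g]
    rw [setIntegral_ball_eq_translate φ x, integral_const_mul]
  have hlow : V * (∫ x, φ x ^ 2 ∂μ - ε ^ 2 / 2 * D) ≤ ∫ x, φ x * g x ∂μ := by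
    rw [← hswap]
    have : V * (∫ x, φ x ^ 2 ∂μ - ε ^ 2 / 2 * D) =
        ∫ h in Metric.ball (0 : E) ε, (∫ x, φ x ^ 2 ∂μ - ε ^ 2 / 2 * D) ∂μ := by
      rw [setIntegral_const, smul_eq_mul]
    rw [this]
    refine setIntegral_mono_on (integrable_const_iff.2 (Or.inr ⟨by simpa using measure_ball_lt_top⟩))
      iprod.integral_prod_right measurableSet_ball fun h hh => ?_
    have h1 := integral_sq_sub_autocorrelation_le (μ := μ) hφ hs h
    have h2 : ‖h‖ ^ 2 ≤ ε ^ 2 :=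
      pow_le_pow_left₀ (norm_nonneg _) (mem_ball_zero_iff.1 hh).le 2
    nlinarith
  have hfin : IsFiniteMeasure (μ.restrict Ω) := ⟨by simpa using hΩfin.lt_top⟩
  have ig : Integrable (fun x => g x ^ 2) (μ.restrict Ω) := by
    refine Integrable.of_bound (hgm.pow 2).aestronglyMeasurable ((∫ y, |φ y| ∂μ) ^ 2)
      (Eventually.of_forall fun x => ?_)
    rw [norm_pow]
    exact pow_le_pow_left₀ (norm_nonneg _) (hgb x) 2
  -- weighted Young inequality, the weight chosen so that half of the left-hand side is absorbed
  have hup : ∫ x, φ x * g x ∂μ ≤ V / 2 * ∫ x, φ x ^ 2 ∂μ + (2 * V)⁻¹ * ∫ x in Ω, g x ^ 2 ∂μ := by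
    rw [← setIntegral_eq_integral_of_forall_compl_eq_zero (s := Ω) (fun x hx => by simp [hsupp x hx]),
      ← setIntegral_eq_integral_of_forall_compl_eq_zero (s := Ω) (f := fun x => φ x ^ 2)
        (fun x hx => by simp [hsupp x hx]), ← integral_const_mul, ← integral_const_mul,
      ← integral_add (i1.restrict.const_mul _) (ig.const_mul _)]
    refine integral_mono (iφ.restrict.mul_bdd (c := ∫ y, |φ y| ∂μ) hgm.aestronglyMeasurable
      (Eventually.of_forall hgb)) ((i1.restrict.const_mul _).add (ig.const_mul _)) fun x => ?_
    have h1 : V / 2 * φ x ^ 2 + (2 * V)⁻¹ * g x ^ 2 - φ x * g x =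
        (2 * V)⁻¹ * (V * φ x - g x) ^ 2 := by field_simp; ring
    have h2 : 0 ≤ (2 * V)⁻¹ * (V * φ x - g x) ^ 2 := by positivity
    simp only
    linarith
  have h3 : V * (∫ x, φ x ^ 2 ∂μ) ≤ V * (ε ^ 2 * D + (V ^ 2)⁻¹ * ∫ x in Ω, g x ^ 2 ∂μ) := by
    have h4 : V * ((V ^ 2)⁻¹ * ∫ x in Ω, g x ^ 2 ∂μ) = 2 * ((2 * V)⁻¹ * ∫ x in Ω, g x ^ 2 ∂μ) := by
      field_simp
    rw [mul_add, h4]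
    nlinarith
  exact le_of_mul_le_mul_left h3 hV0

/-- Rellich's theorem for test functions: a sequence with bounded gradients whose integrals over all
balls tend to zero tends to zero in `L²`. -/
theorem tendsto_integral_sq_zero {φ : ℕ → E → ℝ} (hφ : ∀ k, ContDiff ℝ 1 (φ k))
    (hs : ∀ k, HasCompactSupport (φ k)) {Ω : Set E} (hΩfin : μ Ω ≠ ⊤)
    (hsupp : ∀ k, ∀ x ∉ Ω, φ k x = 0) {M : ℝ} (hM : ∀ k, ∫ x, ‖fderiv ℝ (φ k) x‖ ^ 2 ∂μ ≤ M)
    {M' : ℝ} (hM' : ∀ k, ∫ x, φ k x ^ 2 ∂μ ≤ M')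
    (hweak : ∀ x ε, Tendsto (fun k => ∫ y in Metric.ball x ε, φ k y ∂μ) atTop (𝓝 0)) :
    Tendsto (fun k => ∫ x, φ k x ^ 2 ∂μ) atTop (𝓝 0) := by
  have hfin : IsFiniteMeasure (μ.restrict Ω) := ⟨by simpa using hΩfin.lt_top⟩
  have i1 : ∀ k, Integrable (fun x => φ k x ^ 2) μ := fun k =>
    integrable_sq_of_hasCompactSupport (hφ k) (hs k)
  have iφ : ∀ k, Integrable (φ k) μ := fun k =>
    (hφ k).continuous.integrable_of_hasCompactSupport (hs k)
  set C := μ.real Ω + M' with hC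
  have hL1 : ∀ k, ∫ x, |φ k x| ∂μ ≤ C := by
    intro k
    rw [← setIntegral_eq_integral_of_forall_compl_eq_zero (s := Ω)
      (fun x hx => by simp [hsupp k x hx])]
    calc ∫ x in Ω, |φ k x| ∂μ ≤ ∫ x in Ω, (1 + φ k x ^ 2) ∂μ := by
          refine integral_mono (iφ k).restrict.abs ((integrable_const _).add (i1 k).restrict)
            fun x => ?_
          simp only
          rw [← sq_abs]
          nlinarith [sq_nonneg (|φ k x| - 1), abs_nonneg (φ k x)]
      _ = μ.real Ω + ∫ x in Ω, φ k x ^ 2 ∂μ := by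
          rw [integral_add (integrable_const _) (i1 k).restrict]; simp
      _ ≤ C := by
          have := setIntegral_le_integral (s := Ω) (i1 k)
            (Eventually.of_forall fun x => sq_nonneg (φ k x))
          linarith [hM' k]
  have hdct : ∀ ε : ℝ, Tendsto (fun k => ∫ x in Ω, (∫ y in Metric.ball x ε, φ k y ∂μ) ^ 2 ∂μ)
      atTop (𝓝 0) := by
    intro ε
    have := tendsto_integral_of_dominated_convergence (μ := μ.restrict Ω)
      (F := fun k x => (∫ y in Metric.ball x ε, φ k y ∂μ) ^ 2) (f := fun _ => 0) (fun _ => C ^ 2)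
      (fun k => ((stronglyMeasurable_setIntegral_ball (hφ k).continuous ε).pow 2).aestronglyMeasurable)
      (integrable_const _) (fun k => Eventually.of_forall fun x => ?_)
      (Eventually.of_forall fun x => by simpa using (hweak x ε).pow 2)
    · simpa using this
    · rw [norm_pow]
      refine pow_le_pow_left₀ (norm_nonneg _) (le_trans ?_ (hL1 k)) 2
      exact (norm_integral_le_integral_norm _).trans
        (setIntegral_le_integral (iφ k).norm (Eventually.of_forall fun y => norm_nonneg _))
  have hM0 : 0 ≤ M := (integral_nonneg fun x => by positivity).trans (hM 0)
  rw [Metric.tendsto_atTop]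
  intro δ hδ
  -- `ε` is chosen so that the gradient term contributes less than `δ / 2`
  set ε := Real.sqrt (δ / (2 * (M + 1))) with hεdef
  have hε : 0 < ε := Real.sqrt_pos.2 (by positivity)
  have hεsq : ε ^ 2 = δ / (2 * (M + 1)) := Real.sq_sqrt (by positivity)
  have hεM : ε ^ 2 * M < δ / 2 := by
    rw [hεsq, div_mul_eq_mul_div, div_lt_iff₀ (by positivity)]
    nlinarith
  have h0 := (hdct ε).const_mul (((μ.real (Metric.ball (0 : E) ε)) ^ 2)⁻¹)
  rw [mul_zero] at h0
  obtain ⟨N, hN⟩ := eventually_atTop.1 (h0.eventually (gt_mem_nhds (half_pos hδ)))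
  refine ⟨N, fun k hk => ?_⟩
  have h1 := integral_sq_le_add_average (μ := μ) (hφ k) (hs k) hΩfin (hsupp k) hε
  have h2 := mul_le_mul_of_nonneg_left (hM k) (sq_nonneg ε)
  have h3 := hN k hk
  rw [Real.dist_eq, sub_zero, abs_of_nonneg (integral_nonneg fun x => sq_nonneg _)]
  linarith

end Translation

/-! ### Test functions and weak gradients -/

section Sobolev

variable {n : ℕ} {Ω : Set (EuclideanSpace ℝ (Fin n))}

theorem Lp_norm_sq_eq_integral {X F : Type*} [MeasurableSpace X] {μ : Measure X}
    [NormedAddCommGroup F] [InnerProductSpace ℝ F] (f : Lp F 2 μ) :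
    ‖f‖ ^ 2 = ∫ x, ‖f x‖ ^ 2 ∂μ := by
  rw [← real_inner_self_eq_norm_sq, L2.inner_def]
  simp_rw [real_inner_self_eq_norm_sq]

theorem IsTestFunction.eq_zero_of_notMem {φ : EuclideanSpace ℝ (Fin n) → ℝ}
    (hφ : IsTestFunction Ω φ) {x : EuclideanSpace ℝ (Fin n)} (hx : x ∉ Ω) : φ x = 0 :=
  image_eq_zero_of_notMem_tsupport fun h => hx (hφ.2.2 h)

theorem IsTestFunction.fderiv_eq_zero_of_notMem {φ : EuclideanSpace ℝ (Fin n) → ℝ}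
    (hφ : IsTestFunction Ω φ) {x : EuclideanSpace ℝ (Fin n)} (hx : x ∉ Ω) : fderiv ℝ φ x = 0 :=
  image_eq_zero_of_notMem_tsupport fun h => hx (hφ.2.2 (tsupport_fderiv_subset ℝ h))

theorem IsTestFunction.contDiff_one {φ : EuclideanSpace ℝ (Fin n) → ℝ}
    (hφ : IsTestFunction Ω φ) : ContDiff ℝ 1 φ := hφ.1.of_le (by exact_mod_cast le_top)

theorem IsWeakGradient.ae_unique (hΩ : IsOpen Ω) [IsFiniteMeasure (volume.restrict Ω)]
    {u : EuclideanSpace ℝ (Fin n) → ℝ} {g g' : EuclideanSpace ℝ (Fin n) → EuclideanSpace ℝ (Fin n)}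
    (hg : MemLp g 2 (volume.restrict Ω)) (hg' : MemLp g' 2 (volume.restrict Ω))
    (h : IsWeakGradient Ω u g) (h' : IsWeakGradient Ω u g') : g =ᵐ[volume.restrict Ω] g' := by
  have hi := (hg.sub hg').integrable one_le_two
  have hz : ∀ᵐ x ∂volume, x ∈ Ω → (g - g') x = 0 := by
    refine hΩ.ae_eq_zero_of_integral_contDiff_smul_eq_zero
      (IntegrableOn.locallyIntegrableOn hi) fun ψ hψ hψc hψΩ => ?_
    have hψt : IsTestFunction Ω ψ := ⟨hψ, hψc, hψΩ⟩
    rw [← setIntegral_eq_integral_of_forall_compl_eq_zero (s := Ω)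
      fun x hx => by rw [hψt.eq_zero_of_notMem hx, zero_smul]]
    have hint : Integrable (fun x => ψ x • (g - g') x) (volume.restrict Ω) :=
      memLp_one_iff_integrable.1 ((hg.sub hg').smul hψt.memLp)
    refine ext_inner_left ℝ fun v => ?_
    rw [inner_zero_right, ← integral_inner hint]
    have e : ∀ x, inner ℝ v (ψ x • (g - g') x) = inner ℝ (g x) v * ψ x - inner ℝ (g' x) v * ψ x := by
      intro x
      rw [real_inner_smul_right, Pi.sub_apply, inner_sub_right, real_inner_comm v,
        real_inner_comm v]
      ring
    simp_rw [e]
    have i1 : Integrable (fun x => inner ℝ (g x) v * ψ x) (volume.restrict Ω) :=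
      (hg.inner_const v).integrable_mul hψt.memLp
    have i2 : Integrable (fun x => inner ℝ (g' x) v * ψ x) (volume.restrict Ω) :=
      (hg'.inner_const v).integrable_mul hψt.memLp
    rw [integral_sub i1 i2]
    have a := h ψ hψt v
    have b := h' ψ hψt v
    linarith
  filter_upwards [(ae_restrict_iff' hΩ.measurableSet).2 hz] with x hx
  exact sub_eq_zero.1 hx

theorem IsTestFunction.isWeakGradient_gradient {φ : EuclideanSpace ℝ (Fin n) → ℝ}
    (hφ : IsTestFunction Ω φ) : IsWeakGradient Ω φ (gradient φ) := by
  intro ψ hψ v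
  have hin : ∀ x, inner ℝ (gradient φ x) v = fderiv ℝ φ x v := fun x =>
    InnerProductSpace.toDual_symm_apply
  simp_rw [hin]
  rw [setIntegral_eq_integral_of_forall_compl_eq_zero fun x hx => by
      rw [hφ.eq_zero_of_notMem hx, zero_mul],
    setIntegral_eq_integral_of_forall_compl_eq_zero fun x hx => by
      rw [hψ.eq_zero_of_notMem hx, mul_zero]]
  have c1 := hφ.1.continuous
  have c2 := hψ.1.continuous
  have d1 : Continuous fun x => fderiv ℝ φ x v :=
    (hφ.1.continuous_fderiv (by simp)).clm_apply continuous_const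
  have d2 : Continuous fun x => fderiv ℝ ψ x v :=
    (hψ.1.continuous_fderiv (by simp)).clm_apply continuous_const
  refine integral_mul_fderiv_eq_neg_fderiv_mul_of_integrable ?_ ?_ ?_
    (fun x _ => hφ.1.differentiable (by simp) x) (fun x _ => hψ.1.differentiable (by simp) x)
  · exact (d1.mul c2).integrable_of_hasCompactSupport hψ.2.1.mul_left
  · exact (c1.mul d2).integrable_of_hasCompactSupport hφ.2.1.mul_right
  · exact (c1.mul c2).integrable_of_hasCompactSupport hφ.2.1.mul_right

theorem IsTestFunction.memLp_gradient {φ : EuclideanSpace ℝ (Fin n) → ℝ}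
    (hφ : IsTestFunction Ω φ) : MemLp (gradient φ) 2 (volume.restrict Ω) := by
  have hc : Continuous (gradient φ) :=
    (InnerProductSpace.toDual ℝ _).symm.continuous.comp (hφ.1.continuous_fderiv (by simp))
  have hs : HasCompactSupport (gradient φ) :=
    (hφ.2.1.fderiv ℝ).comp_left (g := (InnerProductSpace.toDual ℝ _).symm) (map_zero _)
  exact (hc.memLp_of_hasCompactSupport hs).restrict Ω

/-! ### `H¹₀(Ω)` as a space of pairs -/

/-- The Hilbert space of pairs `(u, g)` with `u ∈ L²(Ω)` and `g ∈ L²(Ω; ℝⁿ)`, with norm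
`(‖u‖² + ‖g‖²)^(1/2)`. -/
abbrev SobolevPair (Ω : Set (EuclideanSpace ℝ (Fin n))) :=
  WithLp 2 (Lp ℝ 2 (volume.restrict Ω) × Lp (EuclideanSpace ℝ (Fin n)) 2 (volume.restrict Ω))

/-- `H¹₀(Ω)` as a subspace of the space of pairs `(u, g)`. It has the same elements as `H10 Ω`, which
is a subspace of the subspace `H1 Ω`; with a single level of nesting, instances on it are much
cheaper to unify. -/
noncomputable def H10Pairs (Ω : Set (EuclideanSpace ℝ (Fin n))) : Submodule ℝ (SobolevPair Ω) :=
  (H10 Ω).map (H1 Ω).subtype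

/-- The inclusion of `H¹₀(Ω)` in `L²(Ω)`. -/
noncomputable def valueL (Ω : Set (EuclideanSpace ℝ (Fin n))) :
    H10Pairs Ω →L[ℝ] Lp ℝ 2 (volume.restrict Ω) :=
  (WithLp.fstL 2 ℝ _ _).comp (H10Pairs Ω).subtypeL

/-- The weak gradient, as a bounded operator from `H¹₀(Ω)` to `L²(Ω; ℝⁿ)`. -/
noncomputable def gradL (Ω : Set (EuclideanSpace ℝ (Fin n))) :
    H10Pairs Ω →L[ℝ] Lp (EuclideanSpace ℝ (Fin n)) 2 (volume.restrict Ω) :=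
  (WithLp.sndL 2 ℝ _ _).comp (H10Pairs Ω).subtypeL

theorem norm_sq_eq_valueL_add_gradL (u : H10Pairs Ω) :
    ‖u‖ ^ 2 = ‖valueL Ω u‖ ^ 2 + ‖gradL Ω u‖ ^ 2 :=
  WithLp.prod_norm_sq_eq_of_L2 _

theorem isWeakGradient_gradL (u : H10Pairs Ω) : IsWeakGradient Ω (valueL Ω u) (gradL Ω u) := by
  obtain ⟨w, -, hw⟩ := u.2
  have h : IsWeakGradient Ω w.1.fst w.1.snd := w.2
  rw [show w.1 = u.1 from hw] at h
  exact h

/-- The equations that define a weak gradient are equalities of inner products with fixed elements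
of `L²`, hence closed conditions. -/
theorem isClosed_H1 : IsClosed (H1 Ω : Set (SobolevPair Ω)) := by
  have e : (H1 Ω : Set (SobolevPair Ω)) =
      ⋂ (φ : EuclideanSpace ℝ (Fin n) → ℝ) (_ : IsTestFunction Ω φ)
        (v : EuclideanSpace ℝ (Fin n)),
        {w | ∫ x in Ω, w.fst x * fderiv ℝ φ x v = - ∫ x in Ω, inner ℝ (w.snd x) v * φ x} := by
    ext w
    simp only [Set.mem_iInter, Set.mem_ofPred_eq]
    rfl
  rw [e]
  refine isClosed_iInter fun φ => isClosed_iInter fun hφ => isClosed_iInter fun v => ?_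
  have h1 : ∀ w : SobolevPair Ω,
      ∫ x in Ω, w.fst x * fderiv ℝ φ x v = inner ℝ ((hφ.memLp_fderiv v).toLp) w.fst := by
    intro w
    rw [L2.inner_def]
    refine integral_congr_ae ?_
    filter_upwards [(hφ.memLp_fderiv v).coeFn_toLp] with x hx
    rw [hx]
    rfl
  have hm : MemLp (fun x => φ x • v) 2 (volume.restrict Ω) :=
    ((hφ.1.continuous.smul continuous_const).memLp_of_hasCompactSupport
      hφ.2.1.smul_right).restrict Ω
  have h2 : ∀ w : SobolevPair Ω,
      ∫ x in Ω, inner ℝ (w.snd x) v * φ x = inner ℝ w.snd hm.toLp := by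
    intro w
    rw [L2.inner_def]
    refine integral_congr_ae ?_
    filter_upwards [hm.coeFn_toLp] with x hx
    rw [hx, real_inner_smul_right, mul_comm]
  simp_rw [h1, h2]
  exact isClosed_eq (continuous_const.inner (WithLp.fstL 2 ℝ _ _).continuous)
    ((WithLp.sndL 2 ℝ _ _).continuous.inner continuous_const).neg

theorem isClosed_H10Pairs : IsClosed (H10Pairs Ω : Set (SobolevPair Ω)) :=
  isClosed_H1.isClosedEmbedding_subtypeVal.isClosedMap _
    (Submodule.isClosed_topologicalClosure (testSubspace Ω))

instance completeSpace_H10Pairs : CompleteSpace (H10Pairs Ω) := by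
  have h := isClosed_H10Pairs (Ω := Ω)
  have h' := h.isComplete
  exact h'.completeSpace_coe

theorem exists_test_approx (w : H10Pairs Ω) {δ : ℝ} (hδ : 0 < δ) :
    ∃ w' : H10Pairs Ω, dist w w' < δ ∧
      ∃ φ, IsTestFunction Ω φ ∧ valueL Ω w' =ᵐ[volume.restrict Ω] φ := by
  obtain ⟨u, hu, huw⟩ := w.2
  have h := Metric.mem_closure_iff.1 (show u ∈ closure (testSubspace Ω : Set (H1 Ω)) from hu) δ hδ
  obtain ⟨a, ha, hwa⟩ := h
  have hmem : a.1 ∈ H10Pairs Ω := ⟨a, (testSubspace Ω).le_topologicalClosure ha, rfl⟩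
  have hd : dist (w : SobolevPair Ω) a.1 < δ := by
    rw [← huw]; exact hwa
  exact ⟨⟨a.1, hmem⟩, hd, ha.imp fun φ hφ => ⟨hφ.1, hφ.2⟩⟩

theorem norm_valueL_sq_of_ae_eq {w : H10Pairs Ω} {φ : EuclideanSpace ℝ (Fin n) → ℝ}
    (hφ : IsTestFunction Ω φ) (hval : valueL Ω w =ᵐ[volume.restrict Ω] φ) :
    ‖valueL Ω w‖ ^ 2 = ∫ x, φ x ^ 2 := by
  rw [Lp_norm_sq_eq_integral, ← setIntegral_eq_integral_of_forall_compl_eq_zero (s := Ω)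
    (f := fun x => φ x ^ 2) fun x hx => by simp [hφ.eq_zero_of_notMem hx]]
  refine integral_congr_ae ?_
  filter_upwards [hval] with x hx
  rw [hx, Real.norm_eq_abs, sq_abs]

theorem norm_gradL_sq_of_ae_eq (hΩ : IsOpen Ω) [IsFiniteMeasure (volume.restrict Ω)]
    {w : H10Pairs Ω} {φ : EuclideanSpace ℝ (Fin n) → ℝ}
    (hφ : IsTestFunction Ω φ) (hval : valueL Ω w =ᵐ[volume.restrict Ω] φ) :
    ‖gradL Ω w‖ ^ 2 = ∫ x, ‖fderiv ℝ φ x‖ ^ 2 := by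
  have hwg : IsWeakGradient Ω φ (gradL Ω w) := by
    intro ψ hψ v
    rw [← isWeakGradient_gradL w ψ hψ v]
    refine integral_congr_ae ?_
    filter_upwards [hval] with x hx
    rw [hx]
  have hg : gradL Ω w =ᵐ[volume.restrict Ω] gradient φ :=
    IsWeakGradient.ae_unique hΩ (Lp.memLp _) hφ.memLp_gradient hwg hφ.isWeakGradient_gradient
  rw [Lp_norm_sq_eq_integral, ← setIntegral_eq_integral_of_forall_compl_eq_zero (s := Ω)
    (f := fun x => ‖fderiv ℝ φ x‖ ^ 2) fun x hx => by simp [hφ.fderiv_eq_zero_of_notMem hx]]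
  refine integral_congr_ae ?_
  filter_upwards [hg] with x hx
  rw [hx, gradient, LinearIsometryEquiv.norm_map]


theorem gradL_eq_zero_of_valueL_eq_zero (hΩ : IsOpen Ω) [IsFiniteMeasure (volume.restrict Ω)]
    {u : H10Pairs Ω} (h : valueL Ω u = 0) : gradL Ω u = 0 := by
  have h0 : valueL Ω u =ᵐ[volume.restrict Ω] (fun _ => (0 : ℝ)) :=
    Lp.eq_zero_iff_ae_eq_zero.1 h
  have hw : IsWeakGradient Ω (valueL Ω u) (fun _ => 0) := by
    intro φ _ v
    have e : ∫ x in Ω, valueL Ω u x * fderiv ℝ φ x v = 0 := by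
      refine integral_eq_zero_of_ae ?_
      filter_upwards [h0] with x hx
      simp [hx]
    simp [e]
  exact Lp.eq_zero_iff_ae_eq_zero.2
    (IsWeakGradient.ae_unique hΩ (Lp.memLp _) MemLp.zero' (isWeakGradient_gradL u) hw)

theorem IsTestFunction.exists_coe {φ : EuclideanSpace ℝ (Fin n) → ℝ} (hφ : IsTestFunction Ω φ) :
    ∃ w : H10 Ω, h1Fun (w : H1 Ω) =ᵐ[volume.restrict Ω] φ := by
  set a : SobolevPair Ω :=
    WithLp.toLp 2 (hφ.memLp.toLp, hφ.memLp_gradient.toLp) with ha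
  have h1 := hφ.memLp.coeFn_toLp
  have h2 := hφ.memLp_gradient.coeFn_toLp
  have hmem : a ∈ H1 Ω := by
    intro ψ hψ v
    have e1 : ∫ x in Ω, a.fst x * fderiv ℝ ψ x v = ∫ x in Ω, φ x * fderiv ℝ ψ x v := by
      refine integral_congr_ae ?_
      filter_upwards [h1] with x hx
      exact congrArg (· * fderiv ℝ ψ x v) hx
    have e2 : ∫ x in Ω, inner ℝ (a.snd x) v * ψ x = ∫ x in Ω, inner ℝ (gradient φ x) v * ψ x := by
      refine integral_congr_ae ?_
      filter_upwards [h2] with x hx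
      exact congrArg (fun y => inner ℝ y v * ψ x) hx
    exact e1.trans ((hφ.isWeakGradient_gradient ψ hψ v).trans (congrArg Neg.neg e2.symm))
  exact ⟨⟨⟨a, hmem⟩, (testSubspace Ω).le_topologicalClosure ⟨φ, hφ, h1⟩⟩, h1⟩


/-! ### The properties of `H¹₀(Ω)` used in the minimization -/

theorem exists_isTestFunction_not_ae_zero (hΩ : IsOpen Ω) (hne : Ω.Nonempty) :
    ∃ φ : EuclideanSpace ℝ (Fin n) → ℝ, IsTestFunction Ω φ ∧
      ¬ φ =ᵐ[volume.restrict Ω] fun _ => 0 := by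
  obtain ⟨c, hc⟩ := hne
  obtain ⟨r, hr, hball⟩ := Metric.isOpen_iff.1 hΩ c hc
  set ψ : ContDiffBump c := ⟨r / 4, r / 2, by positivity, by linarith⟩ with hψ
  refine ⟨ψ, ⟨ψ.contDiff, ψ.hasCompactSupport, ?_⟩, fun h => ?_⟩
  · rw [ψ.tsupport_eq]
    exact (Metric.closedBall_subset_ball (by simp [hψ]; linarith)).trans hball
  · have h1 := Measure.eqOn_open_of_ae_eq h hΩ ψ.continuous.continuousOn continuousOn_const hc
    have h2 : ψ c = 1 := ψ.one_of_mem_closedBall (Metric.mem_closedBall_self ψ.rIn_pos.le)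
    exact one_ne_zero (h2.symm.trans h1)

theorem H10.coe_coe_eq_zero {u : H10 Ω} : ((u : H1 Ω) : SobolevPair Ω) = 0 ↔ u = 0 :=
  (Submodule.coe_eq_zero (p := H1 Ω)).trans (Submodule.coe_eq_zero (p := H10 Ω))

theorem h1Fun_ae_zero_of_coe_eq_zero {u : H1 Ω} (h : (u : SobolevPair Ω) = 0) :
    h1Fun u =ᵐ[volume.restrict Ω] fun _ => 0 := by
  have h1 : (u : SobolevPair Ω).fst = 0 := by rw [h]; rfl
  have h2 := (Lp.eq_zero_iff_ae_eq_zero (p := 2)).1 h1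
  exact h2

theorem H10.ne_zero_of_h1Fun_ae_eq {w : H10 Ω} {φ : EuclideanSpace ℝ (Fin n) → ℝ}
    (hw : h1Fun (w : H1 Ω) =ᵐ[volume.restrict Ω] φ)
    (hφ : ¬ φ =ᵐ[volume.restrict Ω] fun _ => 0) : w ≠ 0 :=
  fun h0 => hφ (hw.symm.trans (h1Fun_ae_zero_of_coe_eq_zero (H10.coe_coe_eq_zero.2 h0)))

theorem exists_H10_ne_zero (hΩ : IsOpen Ω) (hne : Ω.Nonempty) : ∃ u : H10 Ω, u ≠ 0 :=
  (exists_isTestFunction_not_ae_zero hΩ hne).elim fun _ hφ =>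
    hφ.1.exists_coe.imp fun _ hw => H10.ne_zero_of_h1Fun_ae_eq hw hφ.2

/-- The properties of `H¹₀(Ω)` on which the minimization depends, for an abstract inner product space
`H` with operators `V` (underlying function) and `G` (weak gradient): the norm is the Sobolev norm,
the function determines its weak gradient, and test functions are dense. -/
structure IsH10Model {H : Type*} [NormedAddCommGroup H] [InnerProductSpace ℝ H]
    (V : H →L[ℝ] Lp ℝ 2 (volume.restrict Ω))
    (G : H →L[ℝ] Lp (EuclideanSpace ℝ (Fin n)) 2 (volume.restrict Ω)) : Prop where
  norm_sq : ∀ u, ‖u‖ ^ 2 = ‖V u‖ ^ 2 + ‖G u‖ ^ 2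
  grad_eq_zero : ∀ u, V u = 0 → G u = 0
  approx : ∀ w : H, ∀ δ : ℝ, 0 < δ → ∃ w' : H, dist w w' < δ ∧
      ∃ φ, IsTestFunction Ω φ ∧ V w' =ᵐ[volume.restrict Ω] φ ∧
        ‖V w'‖ ^ 2 = ∫ x, φ x ^ 2 ∧ ‖G w'‖ ^ 2 = ∫ x, ‖fderiv ℝ φ x‖ ^ 2

theorem isH10Model_H10Pairs (hΩ : IsOpen Ω) [IsFiniteMeasure (volume.restrict Ω)] :
    IsH10Model (valueL Ω) (gradL Ω) where
  norm_sq := norm_sq_eq_valueL_add_gradL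
  grad_eq_zero := fun _ => gradL_eq_zero_of_valueL_eq_zero hΩ
  approx := fun w δ hδ => by
    obtain ⟨w', hw', φ, hφ, hae⟩ := exists_test_approx w hδ
    exact ⟨w', hw', φ, hφ, hae, norm_valueL_sq_of_ae_eq hφ hae, norm_gradL_sq_of_ae_eq hΩ hφ hae⟩

theorem IsH10Model.eq_zero {H : Type*} [NormedAddCommGroup H] [InnerProductSpace ℝ H]
    {V : H →L[ℝ] Lp ℝ 2 (volume.restrict Ω)}
    {G : H →L[ℝ] Lp (EuclideanSpace ℝ (Fin n)) 2 (volume.restrict Ω)} (hm : IsH10Model V G)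
    {u : H} (h : V u = 0) : u = 0 := by
  have hn := hm.norm_sq u
  rw [h, hm.grad_eq_zero u h] at hn
  simpa using hn

end Sobolev

/-! ### Poincaré inequality and compactness -/

section Variational

variable {n : ℕ} {Ω : Set (EuclideanSpace ℝ (Fin n))} {H : Type*} [NormedAddCommGroup H]
  [InnerProductSpace ℝ H] {V : H →L[ℝ] Lp ℝ 2 (volume.restrict Ω)}
  {G : H →L[ℝ] Lp (EuclideanSpace ℝ (Fin n)) 2 (volume.restrict Ω)}

theorem IsH10Model.exists_poincare (hm : IsH10Model V G) [Nontrivial (EuclideanSpace ℝ (Fin n))]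
    (hb : Bornology.IsBounded Ω) : ∃ C : ℝ, 0 ≤ C ∧ ∀ w : H, ‖V w‖ ^ 2 ≤ C * ‖G w‖ ^ 2 := by
  obtain ⟨R, hR⟩ := hb.subset_closedBall 0
  obtain ⟨h, hh⟩ := exists_norm_eq (EuclideanSpace ℝ (Fin n)) (c := 2 * |R| + 1) (by positivity)
  refine ⟨‖h‖ ^ 2 / 2, by positivity, fun w => ?_⟩
  have hcl : IsClosed {w : H | ‖V w‖ ^ 2 ≤ ‖h‖ ^ 2 / 2 * ‖G w‖ ^ 2} :=
    isClosed_le (by fun_prop) (by fun_prop)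
  refine hcl.closure_subset (Metric.mem_closure_iff.2 fun δ hδ => ?_)
  obtain ⟨w', hw', φ, hφ, -, h1, h2⟩ := hm.approx w δ hδ
  refine ⟨w', ?_, hw'⟩
  rw [Set.mem_ofPred_eq, h1, h2]
  refine integral_sq_le_of_disjoint_translate hφ.contDiff_one hφ.2.1 fun x => ?_
  by_contra hne
  have hx : x ∈ Ω := by
    by_contra hx
    exact hne (by rw [hφ.eq_zero_of_notMem hx, zero_mul])
  have hxh : x + h ∈ Ω := by
    by_contra hx
    exact hne (by rw [hφ.eq_zero_of_notMem hx, mul_zero])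
  have a1 := mem_closedBall_zero_iff.1 (hR hx)
  have a2 := mem_closedBall_zero_iff.1 (hR hxh)
  have a3 : ‖h‖ ≤ ‖x + h‖ + ‖x‖ := by
    simpa using norm_sub_le (x + h) x
  have := le_abs_self R
  linarith

/-- Rellich's theorem: a weakly null sequence in `H¹₀(Ω)` tends to zero in `L²(Ω)`. Replacing its
members by nearby test functions preserves weak convergence to zero. -/
theorem IsH10Model.tendsto_zero_of_weakly (hm : IsH10Model V G) (hb : Bornology.IsBounded Ω)
    {w : ℕ → H} {M : ℝ} (hM : ∀ k, ‖w k‖ ≤ M)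
    (hw : ∀ f : H →L[ℝ] ℝ, Tendsto (fun k => f (w k)) atTop (𝓝 0)) :
    Tendsto (fun k => V (w k)) atTop (𝓝 0) := by
  have hfin : IsFiniteMeasure (volume.restrict Ω) := ⟨by simpa using hb.measure_lt_top⟩
  choose w' hw' φ hφ hae hv hg using fun k : ℕ =>
    hm.approx (w k) _ (Nat.one_div_pos_of_nat (α := ℝ) (n := k))
  simp_rw [dist_eq_norm] at hw'
  have hdiff : Tendsto (fun k => w k - w' k) atTop (𝓝 0) :=
    squeeze_zero_norm (fun k => (hw' k).le) tendsto_one_div_add_atTop_nhds_zero_nat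
  have hbd : ∀ k, ‖w' k‖ ≤ M + 1 := by
    intro k
    have h1 : (1 : ℝ) / (k + 1) ≤ 1 := by
      rw [div_le_one (by positivity)]
      linarith [k.cast_nonneg (α := ℝ)]
    have h2 : ‖w' k‖ ≤ ‖w k‖ + ‖w k - w' k‖ := by
      simpa using norm_sub_le (w k) (w k - w' k)
    linarith [hM k, hw' k]
  have hsq : ∀ k, ‖V (w' k)‖ ^ 2 + ‖G (w' k)‖ ^ 2 ≤ (M + 1) ^ 2 := fun k => by
    rw [← hm.norm_sq]
    exact pow_le_pow_left₀ (norm_nonneg _) (hbd k) 2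
  have key : Tendsto (fun k => ∫ x, φ k x ^ 2) atTop (𝓝 0) := by
    refine tendsto_integral_sq_zero (μ := volume) (fun k => (hφ k).contDiff_one)
      (fun k => (hφ k).2.1) hb.measure_lt_top.ne (fun k x hx => (hφ k).eq_zero_of_notMem hx)
      (M := (M + 1) ^ 2) (fun k => ?_) (M' := (M + 1) ^ 2) (fun k => ?_) fun x ε => ?_
    · rw [← hg k]
      linarith [hsq k, sq_nonneg ‖V (w' k)‖]
    · rw [← hv k]
      linarith [hsq k, sq_nonneg ‖G (w' k)‖]
    · set f : H →L[ℝ] ℝ := (innerSL ℝ (indicatorConstLp 2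
        (μ := volume.restrict Ω) (measurableSet_ball (x := x) (ε := ε)) (measure_ne_top _ _)
        (1 : ℝ))).comp V with hf
      have e : ∀ k, ∫ y in Metric.ball x ε, φ k y = f (w k) - f (w k - w' k) := by
        intro k
        rw [map_sub, sub_sub_cancel]
        have : f (w' k) = ∫ y in Metric.ball x ε, V (w' k) y ∂(volume.restrict Ω) :=
          L2.inner_indicatorConstLp_one _ _ _
        rw [this, setIntegral_congr_ae (g := φ k) measurableSet_ball
          ((hae k).mono fun y hy _ => hy), Measure.restrict_restrict measurableSet_ball]
        refine (setIntegral_eq_of_subset_of_forall_sdiff_eq_zero measurableSet_ball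
          Set.inter_subset_left fun y hy => (hφ k).eq_zero_of_notMem fun h => hy.2 ⟨hy.1, h⟩)
      simp_rw [e]
      have h1 := (f.continuous.tendsto 0).comp hdiff
      rw [map_zero] at h1
      simpa using (hw f).sub h1
  have h2 : Tendsto (fun k => V (w' k)) atTop (𝓝 0) := by
    rw [tendsto_zero_iff_norm_tendsto_zero]
    have h3 := key.sqrt
    rw [Real.sqrt_zero] at h3
    refine h3.congr fun k => ?_
    rw [← hv k, Real.sqrt_sq (norm_nonneg _)]
  have h4 := (V.continuous.tendsto 0).comp hdiff
  rw [map_zero] at h4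
  simpa using h4.add h2

theorem IsH10Model.exists_subseq_tendsto [CompleteSpace H] (hm : IsH10Model V G)
    (hb : Bornology.IsBounded Ω) {w : ℕ → H} {M : ℝ} (hM : ∀ k, ‖w k‖ ≤ M) :
    ∃ v : H, ∃ φ : ℕ → ℕ, StrictMono φ ∧
      (∀ f : H →L[ℝ] ℝ, Tendsto (fun k => f (w (φ k))) atTop (𝓝 (f v))) ∧
      Tendsto (fun k => V (w (φ k))) atTop (𝓝 (V v)) := by
  obtain ⟨v, φ, hφ, hlim⟩ := exists_subseq_tendsto_weakly hM
  refine ⟨v, φ, hφ, hlim, ?_⟩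
  have h := hm.tendsto_zero_of_weakly hb (w := fun k => w (φ k) - v) (M := M + ‖v‖)
    (fun k => (norm_sub_le _ _).trans (by linarith [hM (φ k)])) fun f => by
      simpa using (hlim f).sub_const (f v)
  simpa using h.add_const (V v)

end Variational

/-! ### Minimization under the constraint `Q ≤ 0` -/

section Minimization

variable {n : ℕ} {Ω : Set (EuclideanSpace ℝ (Fin n))} {H : Type*} [NormedAddCommGroup H]
  [InnerProductSpace ℝ H]

/-- `∫_Ω |u|^(r+1)`; this is `A(u)` for `r = α` and `B(u)` for `r = β`. -/
noncomputable def powInt (V : H →L[ℝ] Lp ℝ 2 (volume.restrict Ω)) (r : ℝ) (u : H) : ℝ :=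
  ∫ x in Ω, |V u x| ^ (r + 1)

variable {V : H →L[ℝ] Lp ℝ 2 (volume.restrict Ω)}
  {G : H →L[ℝ] Lp (EuclideanSpace ℝ (Fin n)) 2 (volume.restrict Ω)}

theorem powInt_nonneg (r : ℝ) (u : H) : 0 ≤ powInt V r u := integral_nonneg fun x => by positivity

theorem powInt_smul {t : ℝ} (ht : 0 ≤ t) (r : ℝ) (u : H) :
    powInt V r (t • u) = t ^ (r + 1) * powInt V r u := by
  rw [powInt, powInt, ← integral_const_mul]
  refine integral_congr_ae ?_
  filter_upwards [Lp.coeFn_smul t (V u)] with x hx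
  rw [map_smul, hx, Pi.smul_apply, smul_eq_mul, abs_mul, abs_of_nonneg ht,
    Real.mul_rpow ht (abs_nonneg _)]

theorem powInt_pos [IsFiniteMeasure (volume.restrict Ω)] {r : ℝ} (hr0 : 0 ≤ r) (hr1 : r ≤ 1) {u : H}
    (hu : V u ≠ 0) : 0 < powInt V r u := by
  have hp : 0 < r + 1 := by linarith
  refine (powInt_nonneg r u).lt_of_ne' fun h => hu (Lp.eq_zero_iff_ae_eq_zero.2 ?_)
  have hq : ENNReal.ofReal (r + 1) ≤ 2 := by
    rw [← ENNReal.ofReal_ofNat 2]; exact ENNReal.ofReal_le_ofReal (by linarith)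
  rw [powInt, integral_abs_rpow_eq_lpNorm_rpow (Lp.memLp (V u)).1 hp,
    Real.rpow_eq_zero lpNorm_nonneg hp.ne'] at h
  exact (lpNorm_eq_zero ((Lp.memLp (V u)).mono_exponent hq) (by simpa using hp)).1 h

theorem powInt_le [IsFiniteMeasure (volume.restrict Ω)] {r : ℝ} (hr0 : 0 ≤ r) (hr1 : r ≤ 1)
    (u : H) : powInt V r u ≤ volume.real Ω + ‖V u‖ ^ 2 := by
  have hi : Integrable (fun x => ‖V u x‖ ^ 2) (volume.restrict Ω) := 
    (Lp.memLp (V u)).norm.integrable_sq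
  have e : volume.real Ω + ‖V u‖ ^ 2 = ∫ x in Ω, (1 + ‖V u x‖ ^ 2) := by
    rw [Lp_norm_sq_eq_integral, integral_add (integrable_const _) hi]
    simp
  rw [e, powInt]
  refine integral_mono_of_nonneg (Eventually.of_forall fun x => by positivity)
    ((integrable_const _).add hi) (Eventually.of_forall fun x => ?_)
  simp only [Real.norm_eq_abs]
  rcases le_total |V u x| 1 with h | h
  · have h1 := Real.rpow_le_one (abs_nonneg _) h (by linarith : 0 ≤ r + 1)
    nlinarith [sq_nonneg |V u x|]
  · have h1 := Real.rpow_le_rpow_of_exponent_le h (by linarith : r + 1 ≤ 2)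
    rw [Real.rpow_two] at h1
    linarith

theorem powInt_interpolation [IsFiniteMeasure (volume.restrict Ω)] {α β : ℝ} (hα : 0 < α)
    (hαβ : α < β) (hβ : β < 1) (u : H) :
    powInt V β u ≤ powInt V α u ^ ((1 - β) / (1 - α)) * (‖V u‖ ^ 2) ^ ((β - α) / (1 - α)) := by
  have h1α : 0 < 1 - α := by linarith
  have e : (β - α) / (1 - α) = 1 - (1 - β) / (1 - α) := by field_simp; ring
  have h := integral_abs_rpow_interpolation (μ := volume.restrict Ω) (Lp.memLp (V u))
    (p := α + 1) (q := β + 1) (θ := (1 - β) / (1 - α)) (by linarith) (by linarith)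
    (div_nonneg (by linarith) h1α.le) ((div_le_one h1α).2 (by linarith)) (by field_simp; ring)
  rw [Lp_norm_sq_eq_integral, e]
  simpa [powInt] using h

/-- `Q(u) = T(u) - λ B(u) + A(u)`. -/
noncomputable def nehariFunctional (V : H →L[ℝ] Lp ℝ 2 (volume.restrict Ω))
    (G : H →L[ℝ] Lp (EuclideanSpace ℝ (Fin n)) 2 (volume.restrict Ω)) (α β lam : ℝ) (u : H) : ℝ :=
  ‖G u‖ ^ 2 - lam * powInt V β u + powInt V α u

/-- `E(u) = T(u) / 2 - λ B(u) / (β + 1) + A(u) / (α + 1)`. -/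
noncomputable def energyFunctional (V : H →L[ℝ] Lp ℝ 2 (volume.restrict Ω))
    (G : H →L[ℝ] Lp (EuclideanSpace ℝ (Fin n)) 2 (volume.restrict Ω)) (α β lam : ℝ) (u : H) : ℝ :=
  1 / 2 * ‖G u‖ ^ 2 - lam * (1 / (β + 1)) * powInt V β u + 1 / (α + 1) * powInt V α u

/-- On the set `Q ≤ 0` the `L²` norm controls the gradient. With `θ + δ = 1` as below, the constraint
makes both `A` and `T` at most `λ B`, so `A^θ T^δ ≤ λ B`, and interpolation bounds `B` by
`A^θ ‖u‖₂^(2δ)`. -/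
theorem norm_grad_rpow_le_of_nehari_nonpos [IsFiniteMeasure (volume.restrict Ω)] {α β lam : ℝ} (hα : 0 < α)
    (hαβ : α < β) (hβ : β < 1) (hlam : 0 ≤ lam) {u : H} (hu : V u ≠ 0)
    (hq : nehariFunctional V G α β lam u ≤ 0) :
    (‖G u‖ ^ 2) ^ ((β - α) / (1 - α)) ≤ lam * (‖V u‖ ^ 2) ^ ((β - α) / (1 - α)) := by
  have h1α : 0 < 1 - α := by linarith
  have hA := powInt_pos (V := V) hα.le (by linarith) hu
  have hB := powInt_nonneg (V := V) β u
  set θ := (1 - β) / (1 - α) with hθ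
  set δ := (β - α) / (1 - α) with hδ
  have hθδ : θ + δ = 1 := by rw [hθ, hδ]; field_simp; ring
  have hθ0 : 0 ≤ θ := div_nonneg (by linarith) h1α.le
  have hδ0 : 0 ≤ δ := div_nonneg (by linarith) h1α.le
  have hT := sq_nonneg ‖G u‖
  rw [nehariFunctional] at hq
  have h1 : powInt V α u ^ θ * (‖G u‖ ^ 2) ^ δ ≤ lam * powInt V β u := by
    have hlB : 0 < lam * powInt V β u := by linarith
    calc powInt V α u ^ θ * (‖G u‖ ^ 2) ^ δ
        ≤ (lam * powInt V β u) ^ θ * (lam * powInt V β u) ^ δ := by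
          gcongr <;> linarith
      _ = lam * powInt V β u := by rw [← Real.rpow_add hlB, hθδ, Real.rpow_one]
  have h2 := mul_le_mul_of_nonneg_left (powInt_interpolation (V := V) hα hαβ hβ u) hlam
  rw [← hθ, ← hδ] at h2
  have h3 : 0 < powInt V α u ^ θ := Real.rpow_pos_of_pos hA θ
  refine le_of_mul_le_mul_left ?_ h3
  linarith

theorem norm_map_smul_sq {F : Type*} [NormedAddCommGroup F] [NormedSpace ℝ F] (L : H →L[ℝ] F)
    (t : ℝ) (u : H) : ‖L (t • u)‖ ^ 2 = t ^ 2 * ‖L u‖ ^ 2 := by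
  rw [map_smul, norm_smul, mul_pow, Real.norm_eq_abs, sq_abs]

theorem map_smul_ne_zero {F : Type*} [NormedAddCommGroup F] [NormedSpace ℝ F] {L : H →L[ℝ] F}
    {t : ℝ} {u : H} (ht : 0 < t) (hu : L u ≠ 0) : L (t • u) ≠ 0 := by
  rw [map_smul]
  exact smul_ne_zero ht.ne' hu

theorem nehariFunctional_smul {α β lam t : ℝ} (ht : 0 ≤ t) (u : H) : nehariFunctional V G α β lam (t • u) =
    t ^ 2 * ‖G u‖ ^ 2 - lam * (t ^ (β + 1) * powInt V β u) + t ^ (α + 1) * powInt V α u := by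
  rw [nehariFunctional, norm_map_smul_sq, powInt_smul ht, powInt_smul ht]

theorem IsH10Model.norm_grad_pos (hm : IsH10Model V G) [Nontrivial (EuclideanSpace ℝ (Fin n))]
    (hb : Bornology.IsBounded Ω) {u : H} (hu : V u ≠ 0) : 0 < ‖G u‖ := by
  obtain ⟨P, -, hP⟩ := hm.exists_poincare hb
  refine (norm_nonneg _).lt_of_ne' fun h => hu ?_
  have h1 := hP u
  rw [h, zero_pow two_ne_zero, mul_zero] at h1
  exact norm_eq_zero.1 (pow_eq_zero_iff two_ne_zero |>.1 (le_antisymm h1 (sq_nonneg _)))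

theorem IsH10Model.exists_unit_direction (hm : IsH10Model V G)
    [Nontrivial (EuclideanSpace ℝ (Fin n))] (hb : Bornology.IsBounded Ω) {u : H} (hu : V u ≠ 0) :
    ∃ v : H, ‖G v‖ = 1 ∧ ‖G u‖ • v = u := by
  have h := hm.norm_grad_pos hb hu
  refine ⟨‖G u‖⁻¹ • u, ?_, ?_⟩
  · rw [map_smul, norm_smul, norm_inv, norm_norm, inv_mul_cancel₀ h.ne']
  · rw [smul_smul, mul_inv_cancel₀ h.ne', one_smul]

/-- `A` and `B` are bounded by a power of the gradient norm, by reduction to `‖∇v‖₂ = 1`. -/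
theorem IsH10Model.exists_powInt_le (hm : IsH10Model V G) [Nontrivial (EuclideanSpace ℝ (Fin n))]
    (hb : Bornology.IsBounded Ω) {r : ℝ} (hr0 : 0 ≤ r) (hr1 : r ≤ 1) :
    ∃ C : ℝ, 0 ≤ C ∧ ∀ u : H, V u ≠ 0 → powInt V r u ≤ ‖G u‖ ^ (r + 1) * C := by
  have hfin : IsFiniteMeasure (volume.restrict Ω) := ⟨by simpa using hb.measure_lt_top⟩
  obtain ⟨P, hP0, hP⟩ := hm.exists_poincare hb
  refine ⟨volume.real Ω + P, add_nonneg measureReal_nonneg hP0, fun u hu => ?_⟩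
  obtain ⟨v, hv1, hv⟩ := hm.exists_unit_direction hb hu
  have h1 : powInt V r u = ‖G u‖ ^ (r + 1) * powInt V r v := by
    rw [← powInt_smul (norm_nonneg _), hv]
  rw [h1]
  refine mul_le_mul_of_nonneg_left ((powInt_le hr0 hr1 v).trans ?_) (by positivity)
  have h2 := hP v
  rw [hv1] at h2
  linarith

/-- The constraint bounds the gradient norm, because `β + 1 < 2`. -/
theorem IsH10Model.exists_norm_grad_le (hm : IsH10Model V G)
    [Nontrivial (EuclideanSpace ℝ (Fin n))] (hb : Bornology.IsBounded Ω) {α β lam : ℝ}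
    (hβ0 : 0 ≤ β) (hβ : β < 1) (hlam : 0 ≤ lam) :
    ∃ R : ℝ, 0 ≤ R ∧ ∀ u : H, V u ≠ 0 → nehariFunctional V G α β lam u ≤ 0 → ‖G u‖ ≤ R := by
  obtain ⟨C, hC0, hC⟩ := hm.exists_powInt_le hb hβ0 hβ.le
  have h1β : 0 < 1 - β := by linarith
  refine ⟨(lam * C) ^ (1 / (1 - β)), by positivity, fun u hu hq => ?_⟩
  have hg := hm.norm_grad_pos hb hu
  have hA := powInt_nonneg (V := V) α u
  rw [nehariFunctional] at hq
  have h1 : ‖G u‖ ^ (1 - β) ≤ lam * C := by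
    have h2 : ‖G u‖ ^ 2 ≤ lam * (‖G u‖ ^ (β + 1) * C) := by
      linarith [mul_le_mul_of_nonneg_left (hC u hu) hlam]
    have h3 : ‖G u‖ ^ 2 = ‖G u‖ ^ (β + 1) * ‖G u‖ ^ (1 - β) := by
      rw [← Real.rpow_add hg, ← Real.rpow_two]; congr 1; ring
    rw [h3] at h2
    have h5 : 0 < ‖G u‖ ^ (β + 1) := by positivity
    refine le_of_mul_le_mul_left ?_ h5
    linarith
  have h6 := Real.rpow_le_rpow (by positivity) h1 (by positivity : 0 ≤ 1 / (1 - β))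
  rwa [← Real.rpow_mul hg.le, mul_one_div_cancel h1β.ne', Real.rpow_one] at h6

theorem IsH10Model.bddBelow_energy (hm : IsH10Model V G) [Nontrivial (EuclideanSpace ℝ (Fin n))]
    (hb : Bornology.IsBounded Ω) {α β lam : ℝ} (hα : 0 ≤ α) (hβ0 : 0 ≤ β) (hβ : β < 1)
    (hlam : 0 ≤ lam) :
    BddBelow (energyFunctional V G α β lam '' {u | V u ≠ 0 ∧ nehariFunctional V G α β lam u ≤ 0}) := by
  obtain ⟨C, hC0, hC⟩ := hm.exists_powInt_le hb hβ0 hβ.le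
  obtain ⟨R, hR0, hR⟩ := hm.exists_norm_grad_le (α := α) hb hβ0 hβ hlam
  refine ⟨-(lam * (1 / (β + 1)) * (R ^ (β + 1) * C)), ?_⟩
  rintro _ ⟨u, ⟨hu, hq⟩, rfl⟩
  have h1 : powInt V β u ≤ R ^ (β + 1) * C := (hC u hu).trans
    (mul_le_mul_of_nonneg_right
      (Real.rpow_le_rpow (norm_nonneg _) (hR u hu hq) (by positivity)) hC0)
  have h2 : 0 ≤ 1 / (α + 1) * powInt V α u := mul_nonneg (by positivity) (powInt_nonneg _ _)
  have h3 : lam * (1 / (β + 1)) * powInt V β u ≤ lam * (1 / (β + 1)) * (R ^ (β + 1) * C) :=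
    mul_le_mul_of_nonneg_left h1 (by positivity)
  have h4 : 0 ≤ 1 / 2 * ‖G u‖ ^ 2 := by positivity
  rw [energyFunctional]
  linarith

/-- The directions of a sequence in the set `Q ≤ 0` do not converge to zero. -/
theorem ne_zero_of_tendsto [IsFiniteMeasure (volume.restrict Ω)] {α β lam : ℝ} (hα : 0 < α)
    (hαβ : α < β) (hβ : β < 1) (hlam : 0 ≤ lam) {v : ℕ → H} {τ : ℕ → ℝ} {v₀ : H}
    (hG : ∀ k, ‖G (v k)‖ = 1) (hV : ∀ k, V (v k) ≠ 0) (hτ : ∀ k, 0 < τ k)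
    (hq : ∀ k, nehariFunctional V G α β lam (τ k • v k) ≤ 0)
    (hlim : Tendsto (fun k => V (v k)) atTop (𝓝 (V v₀))) : V v₀ ≠ 0 := by
  intro h0
  have hδ0 : 0 < (β - α) / (1 - α) := div_pos (by linarith) (by linarith)
  have h1 : ∀ k, 1 ≤ lam * (‖V (v k)‖ ^ 2) ^ ((β - α) / (1 - α)) := by
    intro k
    have h2 := norm_grad_rpow_le_of_nehari_nonpos hα hαβ hβ hlam (map_smul_ne_zero (hτ k) (hV k)) (hq k)
    rw [norm_map_smul_sq, norm_map_smul_sq, hG, Real.mul_rpow (by positivity) (by positivity),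
      Real.mul_rpow (by positivity) (by positivity), one_pow, Real.one_rpow] at h2
    have h4 : 0 < (τ k ^ 2) ^ ((β - α) / (1 - α)) :=
      Real.rpow_pos_of_pos (pow_pos (hτ k) 2) _
    refine le_of_mul_le_mul_left ?_ h4
    linarith
  have h2 : Tendsto (fun k => lam * (‖V (v k)‖ ^ 2) ^ ((β - α) / (1 - α))) atTop
      (𝓝 (lam * (‖V v₀‖ ^ 2) ^ ((β - α) / (1 - α)))) :=
    ((hlim.norm.pow 2).rpow_const (Or.inr hδ0.le)).const_mul lam
  have h3 := ge_of_tendsto' h2 h1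
  rw [h0, norm_zero, zero_pow two_ne_zero, Real.zero_rpow hδ0.ne', mul_zero] at h3
  exact zero_lt_one.not_ge h3

theorem tendsto_powInt [IsFiniteMeasure (volume.restrict Ω)] {r : ℝ} (h0 : 0 ≤ r) (h1 : r ≤ 1)
    {v : ℕ → H} {v₀ : H} (hlim : Tendsto (fun k => V (v k)) atTop (𝓝 (V v₀))) :
    Tendsto (fun k => powInt V r (v k)) atTop (𝓝 (powInt V r v₀)) :=
  tendsto_integral_abs_rpow (by linarith) (by linarith) hlim

/-- The gradient norms of a sequence in the set `Q ≤ 0` do not tend to zero. -/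
theorem pos_of_tendsto [IsFiniteMeasure (volume.restrict Ω)] {α β lam : ℝ} (hα : 0 < α)
    (hαβ : α < β) (hβ : β < 1) {v : ℕ → H} {τ : ℕ → ℝ} {v₀ : H} {τ₀ : ℝ}
    (hτ : ∀ k, 0 < τ k) (hq : ∀ k, nehariFunctional V G α β lam (τ k • v k) ≤ 0)
    (hlim : Tendsto (fun k => V (v k)) atTop (𝓝 (V v₀))) (hv₀ : V v₀ ≠ 0)
    (hτlim : Tendsto τ atTop (𝓝 τ₀)) : 0 < τ₀ := by
  refine (ge_of_tendsto' hτlim fun k => (hτ k).le).lt_of_ne' fun h0 => ?_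
  have h1 : ∀ k, powInt V α (v k) ≤ lam * (τ k ^ (β - α) * powInt V β (v k)) := by
    intro k
    have h2 := hq k
    rw [nehariFunctional_smul (hτ k).le] at h2
    have h3 : τ k ^ (β + 1) = τ k ^ (α + 1) * τ k ^ (β - α) := by
      rw [← Real.rpow_add (hτ k)]; congr 1; ring
    rw [h3] at h2
    have h4 : 0 < τ k ^ (α + 1) := Real.rpow_pos_of_pos (hτ k) _
    have h5 : 0 ≤ τ k ^ 2 * ‖G (v k)‖ ^ 2 := by positivity
    refine le_of_mul_le_mul_left ?_ h4
    linarith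
  have h2 : Tendsto (fun k => lam * (τ k ^ (β - α) * powInt V β (v k))) atTop
      (𝓝 (lam * (τ₀ ^ (β - α) * powInt V β v₀))) :=
    ((hτlim.rpow_const (Or.inr (by linarith))).mul
      (tendsto_powInt (by linarith) hβ.le hlim)).const_mul lam
  have h3 := le_of_tendsto_of_tendsto' (tendsto_powInt hα.le (by linarith) hlim) h2 h1
  rw [h0, Real.zero_rpow (by linarith), zero_mul, mul_zero] at h3
  exact (powInt_pos hα.le (by linarith) hv₀).not_ge h3

theorem norm_grad_le_one_of_tendsto_weakly {v : ℕ → H} {v₀ : H} (hG : ∀ k, ‖G (v k)‖ = 1)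
    (hweak : ∀ f : H →L[ℝ] ℝ, Tendsto (fun k => f (v k)) atTop (𝓝 (f v₀))) : ‖G v₀‖ ≤ 1 := by
  have h1 : Tendsto (fun k => inner ℝ (G v₀) (G (v k))) atTop (𝓝 (inner ℝ (G v₀) (G v₀))) :=
    hweak ((innerSL ℝ (G v₀)).comp G)
  have h2 : inner ℝ (G v₀) (G v₀) ≤ ‖G v₀‖ := le_of_tendsto' h1 fun k => by
    have := real_inner_le_norm (G v₀) (G (v k))
    rwa [hG, mul_one] at this
  rw [real_inner_self_eq_norm_sq] at h2
  by_contra! h3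
  nlinarith

theorem IsH10Model.exists_minimizer_nonpos [CompleteSpace H] (hm : IsH10Model V G)
    [Nontrivial (EuclideanSpace ℝ (Fin n))] (hb : Bornology.IsBounded Ω)
    {α β lam : ℝ} (hα : 0 < α) (hαβ : α < β) (hβ : β < 1) (hlam : 0 < lam)
    (hne : ∃ u : H, V u ≠ 0 ∧ nehariFunctional V G α β lam u ≤ 0) :
    ∃ u : H, V u ≠ 0 ∧ nehariFunctional V G α β lam u ≤ 0 ∧
      ∀ w : H, V w ≠ 0 → nehariFunctional V G α β lam w ≤ 0 →
        energyFunctional V G α β lam u ≤ energyFunctional V G α β lam w := by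
  have hfin : IsFiniteMeasure (volume.restrict Ω) := ⟨by simpa using hb.measure_lt_top⟩
  have hβ0 : 0 < β := hα.trans hαβ
  obtain ⟨P, -, hP⟩ := hm.exists_poincare hb
  obtain ⟨R, hR0, hR⟩ := hm.exists_norm_grad_le (α := α) hb hβ0.le hβ hlam.le
  have hbdd := hm.bddBelow_energy hb hα.le hβ0.le hβ hlam.le
  obtain ⟨e, -, he, heN⟩ := exists_seq_tendsto_sInf (Set.Nonempty.image _ hne) hbdd
  choose u hu hue using heN
  choose v hv1 hv using fun k => hm.exists_unit_direction hb (hu k).1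
  have hVv : ∀ k, V (v k) ≠ 0 := fun k h => (hu k).1 (by rw [← hv k, map_smul, h, smul_zero])
  -- compactness: the directions converge weakly, the gradient norms in `ℝ`
  have hnormbd : ∀ k, ‖v k‖ ≤ Real.sqrt (P + 1) := by
    intro k
    have h1 := hP (v k)
    rw [hv1] at h1
    refine Real.le_sqrt_of_sq_le ?_
    rw [hm.norm_sq, hv1]
    linarith
  obtain ⟨v₀, φ, hφ, hweak, hstrong⟩ := hm.exists_subseq_tendsto hb hnormbd
  obtain ⟨τ₀, hτ₀, ψ, hψ, hτ⟩ := (isCompact_Icc (a := (0 : ℝ)) (b := R)).isSeqCompact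
    (x := fun k => ‖G (u (φ k))‖) fun k => ⟨norm_nonneg _, hR _ (hu _).1 (hu _).2⟩
  obtain ⟨τ, hτdef⟩ : ∃ τ : ℕ → ℝ, ∀ k, τ k = ‖G (u (φ (ψ k)))‖ := ⟨_, fun _ => rfl⟩
  obtain ⟨y, hydef⟩ : ∃ y : ℕ → H, ∀ k, y k = v (φ (ψ k)) := ⟨_, fun _ => rfl⟩
  have hsmul : ∀ k, τ k • y k = u (φ (ψ k)) := fun k => by rw [hτdef, hydef, hv]
  have hτpos : ∀ k, 0 < τ k := fun k => by rw [hτdef]; exact hm.norm_grad_pos hb (hu _).1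
  have hy1 : ∀ k, ‖G (y k)‖ = 1 := fun k => by rw [hydef, hv1]
  have hyV : ∀ k, V (y k) ≠ 0 := fun k => by rw [hydef]; exact hVv _
  have hq : ∀ k, nehariFunctional V G α β lam (τ k • y k) ≤ 0 := fun k => by rw [hsmul]; exact (hu _).2
  have hτlim : Tendsto τ atTop (𝓝 τ₀) := hτ.congr fun k => (hτdef k).symm
  have hyweak : ∀ f : H →L[ℝ] ℝ, Tendsto (fun k => f (y k)) atTop (𝓝 (f v₀)) := fun f => by
    simp_rw [hydef]
    exact (hweak f).comp hψ.tendsto_atTop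
  have hylim : Tendsto (fun k => V (y k)) atTop (𝓝 (V v₀)) := by
    simp_rw [hydef]
    exact hstrong.comp hψ.tendsto_atTop
  have hElim : Tendsto (fun k => energyFunctional V G α β lam (τ k • y k)) atTop
      (𝓝 (sInf (energyFunctional V G α β lam '' {u | V u ≠ 0 ∧ nehariFunctional V G α β lam u ≤ 0}))) := by
    refine (he.comp (hφ.comp hψ).tendsto_atTop).congr fun k => ?_
    rw [hsmul]
    exact (hue _).symm
  have hv₀ : V v₀ ≠ 0 := ne_zero_of_tendsto hα hαβ hβ hlam.le hy1 hyV hτpos hq hylim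
  have hτ₀pos : 0 < τ₀ := pos_of_tendsto hα hαβ hβ hτpos hq hylim hv₀ hτlim
  have hGv : ‖G v₀‖ ≤ 1 := norm_grad_le_one_of_tendsto_weakly hy1 hyweak
  have hGu : ‖G (τ₀ • v₀)‖ ^ 2 ≤ τ₀ ^ 2 := by
    rw [norm_map_smul_sq]
    exact mul_le_of_le_one_right (sq_nonneg _) (pow_le_one₀ (norm_nonneg _) hGv)
  have hTlim : Tendsto (fun k => ‖G (τ k • y k)‖ ^ 2) atTop (𝓝 (τ₀ ^ 2)) := by
    refine (hτlim.pow 2).congr fun k => ?_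
    rw [norm_map_smul_sq, hy1, one_pow, mul_one]
  have hPlim : Tendsto (fun k => V (τ k • y k)) atTop (𝓝 (V (τ₀ • v₀))) := by
    simp_rw [map_smul]
    exact hτlim.smul hylim
  have hBl := tendsto_powInt hβ0.le hβ.le hPlim
  have hAl := tendsto_powInt hα.le (by linarith) hPlim
  refine ⟨τ₀ • v₀, map_smul_ne_zero hτ₀pos hv₀, ?_, fun w hw hqw => ?_⟩
  · have h1 := le_of_tendsto' ((hTlim.sub (hBl.const_mul lam)).add hAl) hq
    rw [nehariFunctional]
    linarith
  · have h1 := tendsto_nhds_unique hElim (((hTlim.const_mul (1 / 2)).sub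
      (hBl.const_mul (lam * (1 / (β + 1))))).add (hAl.const_mul (1 / (α + 1))))
    have h2 := csInf_le hbdd ⟨w, ⟨hw, hqw⟩, rfl⟩
    refine le_trans ?_ h2
    rw [h1, energyFunctional]
    linarith

/-- A minimizer over `{Q ≤ 0}` is carried along its fiber to `{Q = 0}` without increasing the
energy. -/
theorem IsH10Model.exists_minimizer [CompleteSpace H] (hm : IsH10Model V G)
    [Nontrivial (EuclideanSpace ℝ (Fin n))] (hb : Bornology.IsBounded Ω)
    {α β lam : ℝ} (hα : 0 < α) (hαβ : α < β) (hβ : β < 1) (hlam : 0 < lam)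
    (hne : ∃ u : H, V u ≠ 0 ∧ c1Const α β * (powInt V α u ^ ((1 - β) / (1 - α)) *
      (‖G u‖ ^ 2) ^ ((β - α) / (1 - α)) / powInt V β u) < lam) :
    ∃ u : H, V u ≠ 0 ∧ nehariFunctional V G α β lam u = 0 ∧
      ∀ w : H, V w ≠ 0 → nehariFunctional V G α β lam w = 0 →
        energyFunctional V G α β lam u ≤ energyFunctional V G α β lam w := by
  have hfin : IsFiniteMeasure (volume.restrict Ω) := ⟨by simpa using hb.measure_lt_top⟩
  have hβ0 : 0 < β := hα.trans hαβ
  obtain ⟨z, hz, hzlam⟩ := hne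
  obtain ⟨t, ht, hqt⟩ := exists_fiber_nonpos hαβ hβ (pow_pos (hm.norm_grad_pos hb hz) 2)
    (powInt_pos hα.le (by linarith) hz) (powInt_pos hβ0.le hβ.le hz) hzlam
  obtain ⟨u, hu, hqu, hmin⟩ := hm.exists_minimizer_nonpos hb hα hαβ hβ hlam
    ⟨t • z, map_smul_ne_zero ht hz, by rwa [nehariFunctional_smul ht.le]⟩
  obtain ⟨r, hr1, hr0, hre⟩ := exists_fiber_zero hα hβ hαβ (pow_pos (hm.norm_grad_pos hb hu) 2)
    hqu (powInt_nonneg α u)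
  have hr : 0 < r := by linarith
  refine ⟨r • u, map_smul_ne_zero hr hu, ?_, fun w hw hqw => le_trans ?_ (hmin w hw hqw.le)⟩
  · rw [nehariFunctional_smul hr.le, ← hr0]
    ring
  · rw [energyFunctional, energyFunctional, norm_map_smul_sq, powInt_smul hr.le, powInt_smul hr.le]
    refine le_trans (le_of_eq ?_) (hre.trans (le_of_eq ?_)) <;> ring

end Minimization

/-! ### Return to `H10` -/

section Transfer

variable {n : ℕ} {Ω : Set (EuclideanSpace ℝ (Fin n))}

/-- The pair `(u, ∇u)` of an element of `H10 Ω`. -/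
noncomputable def toPairs (u : H10 Ω) : H10Pairs Ω := ⟨_, u.1, u.2, rfl⟩

theorem exists_toPairs_eq (p : H10Pairs Ω) : ∃ u : H10 Ω, (toPairs u) = p :=
  p.2.elim fun w hw => ⟨⟨w, hw.1⟩, Subtype.ext hw.2⟩

theorem toPairs_eq_zero_iff {u : H10 Ω} : (toPairs u) = 0 ↔ u = 0 :=
  (Submodule.coe_eq_zero (p := H10Pairs Ω)).symm.trans H10.coe_coe_eq_zero

theorem dirichletT_eq_norm_sq (u : H10 Ω) : dirichletT u = ‖gradL Ω (toPairs u)‖ ^ 2 :=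
  (Lp_norm_sq_eq_integral (gradL Ω (toPairs u))).symm

theorem powerIntegral_eq_powInt (r : ℝ) (u : H10 Ω) :
    powerIntegral r u = powInt (valueL Ω) r (toPairs u) := rfl

theorem nehariQ_eq_nehariFunctional (α β lam : ℝ) (u : H10 Ω) :
    nehariQ α β lam u = nehariFunctional (valueL Ω) (gradL Ω) α β lam (toPairs u) := by
  rw [nehariQ, nehariFunctional, dirichletT_eq_norm_sq, powerIntegral_eq_powInt, powerIntegral_eq_powInt]

theorem energyE_eq_energyFunctional (α β lam : ℝ) (u : H10 Ω) :
    energyE α β lam u = energyFunctional (valueL Ω) (gradL Ω) α β lam (toPairs u) := by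
  rw [energyE, energyFunctional, dirichletT_eq_norm_sq, powerIntegral_eq_powInt, powerIntegral_eq_powInt]

theorem IsH10Model.ne_zero_iff {H : Type*} [NormedAddCommGroup H] [InnerProductSpace ℝ H]
    {V : H →L[ℝ] Lp ℝ 2 (volume.restrict Ω)}
    {G : H →L[ℝ] Lp (EuclideanSpace ℝ (Fin n)) 2 (volume.restrict Ω)} (hm : IsH10Model V G)
    {u : H} : V u ≠ 0 ↔ u ≠ 0 :=
  not_congr ⟨hm.eq_zero, fun h => by rw [h, map_zero]⟩

theorem ne_zero_iff_valueL (hΩ : IsOpen Ω) [IsFiniteMeasure (volume.restrict Ω)]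
    {u : H10 Ω} : u ≠ 0 ↔ valueL Ω (toPairs u) ≠ 0 :=
  (not_congr toPairs_eq_zero_iff).symm.trans (isH10Model_H10Pairs hΩ).ne_zero_iff.symm

theorem lambda1_nonneg {α β : ℝ} (hαβ : α < β) (hβ : β < 1) (u : H10 Ω) : 0 ≤ lambda1 α β u := by
  have h1 : 0 < β - α := by linarith
  have h2 : 0 < 1 - β := by linarith
  have h3 : 0 < 1 - α := by linarith
  have a := powInt_nonneg (V := valueL Ω) α (toPairs u)
  have b := powInt_nonneg (V := valueL Ω) β (toPairs u)
  rw [lambda1, fiberQuotient, c1Const, dirichletT_eq_norm_sq, powerIntegral_eq_powInt,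
    powerIntegral_eq_powInt]
  positivity

/-- `sInf` of a set of nonnegative reals is nonnegative, whether or not the set is empty. -/
theorem Lambda1_nonneg {α β : ℝ} (hαβ : α < β) (hβ : β < 1) : 0 ≤ Lambda1 Ω α β :=
  Real.sInf_nonneg fun _ hx => hx.elim fun u hu => hu.2 ▸ lambda1_nonneg hαβ hβ u

theorem exists_lambda1_lt (hΩ : IsOpen Ω) (hne : Ω.Nonempty) {α β lam : ℝ}
    (hlam : Lambda1 Ω α β < lam) : ∃ u : H10 Ω, u ≠ 0 ∧ lambda1 α β u < lam := by
  have hS : {u : H10 Ω | u ≠ 0}.Nonempty := exists_H10_ne_zero hΩ hne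
  have h := exists_lt_of_csInf_lt (hS.image (lambda1 α β)) hlam
  exact h.elim fun _ hx => hx.1.elim fun u hu => ⟨u, hu.1, hu.2.trans_lt hx.2⟩

end Transfer

theorem lemma4p1 (n : ℕ) (hn : 3 ≤ n) (Ω : Set (EuclideanSpace ℝ (Fin n)))
    (hΩ_open : IsOpen Ω) (hΩ_conn : IsConnected Ω) (hΩ_bdd : Bornology.IsBounded Ω)
    (α β : ℝ) (hα : 0 < α) (hαβ : α < β) (hβ : β < 1)
    (lam : ℝ) (hlam : Lambda1 Ω α β < lam) :
    ∃ u₀ : H10 Ω, u₀ ≠ 0 ∧ u₀ ∈ nehariM Ω α β lam ∧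
      IsLeast (energyE α β lam '' nehariM Ω α β lam) (energyE α β lam u₀) := by
  have hfin : IsFiniteMeasure (volume.restrict Ω) := ⟨by simpa using hΩ_bdd.measure_lt_top⟩
  have : Nonempty (Fin n) := ⟨⟨0, by omega⟩⟩
  have hlam0 : 0 < lam := (Lambda1_nonneg hαβ hβ).trans_lt hlam
  refine (exists_lambda1_lt hΩ_open hΩ_conn.nonempty hlam).elim fun z hz => ?_
  have hzlam := hz.2
  rw [lambda1, fiberQuotient, dirichletT_eq_norm_sq, powerIntegral_eq_powInt,
    powerIntegral_eq_powInt] at hzlam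
  refine ((isH10Model_H10Pairs hΩ_open).exists_minimizer hΩ_bdd hα hαβ hβ
    hlam0 ⟨toPairs z, (ne_zero_iff_valueL hΩ_open).1 hz.1, hzlam⟩).elim fun p hp => ?_
  refine (exists_toPairs_eq p).elim fun u₀ hu₀ => ?_
  rw [← hu₀] at hp
  have hM : u₀ ∈ nehariM Ω α β lam :=
    ⟨(ne_zero_iff_valueL hΩ_open).2 hp.1, (nehariQ_eq_nehariFunctional α β lam u₀).trans hp.2.1⟩
  have hmin : ∀ w ∈ nehariM Ω α β lam, energyE α β lam u₀ ≤ energyE α β lam w := fun w hw => by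
    rw [energyE_eq_energyFunctional, energyE_eq_energyFunctional]
    exact hp.2.2 _ ((ne_zero_iff_valueL hΩ_open).1 hw.1)
      ((nehariQ_eq_nehariFunctional α β lam w).symm.trans hw.2)
  exact ⟨u₀, hM.1, hM, ⟨u₀, hM, rfl⟩, Set.forall_mem_image.2 hmin⟩
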